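/- **Theorem 2 (Isserlis–Wick).** Let $\hat a_1,\dots,\hat a_n$, $\hat a_1^\dagger,\dots,\hat a_n^\dagger$ be the annihilation and creation operators on $\bigotimes_{j=1}^n\ell_2$, with $[\hat a_i,\hat a_j^\dagger]=\delta_{ij}$, and let $\mathfrak a=(\hat a_1,\dots,\hat a_n,\hat a_1^\dagger,\dots,\hat a_n^\dagger)^T$. Let $\rho$ be a density operator that is Gaussian with zero mean, i.e. for some complex symmetric $2n\times 2n$ matrix $C$ (the covariance matrix) $$\operatorname{tr}\bigl(e^{i\mathbf z^T\mathfrak a}\rho\bigr)=e^{\frac12(i\mathbf z)^TC(i\mathbf z)}\qquad\text{for all }\mathbf z=(z_1,\dots,z_n,\overline z_1,\dots,\overline z_n)^T,\ z\in\mathbb C^n .$$ Write $\langle X\rangle=\operatorname{tr}(X\rho)$, and let $D$ be the matrix of second central moments, $D_{ij}=\langle\mathfrak a_i\mathfrak a_j\rangle-\langle\mathfrak a_i\rangle\langle\mathfrak a_j\rangle$. Then $D=C-\frac12J$ with $J=\begin{pmatrix}0&-I_n\\ I_n&0\end{pmatrix}$. Moreover, for every finite set $I=\{j_1<\dots<j_m\}\subset\mathbb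 N$ and every choice of components $c(j)\in\{1,\dots,2n\}$, $j\in I$, the operator $\mathfrak a_{c(j_1)}\cdots\mathfrak a_{c(j_m)}\,\rho$ is everywhere defined and trace class, and $$\langle\mathfrak a_{c(j_1)}\cdots\mathfrak a_{c(j_m)}\rangle=\begin{cases}\displaystyle\sum_{I=p_1\sqcup\dots\sqcup p_{m/2}}D_{p_1}\cdots D_{p_{m/2}},&m\text{ even},\\[2mm]0,&m\text{ odd},\end{cases}$$ where the sum runs over all pairings of $I$ (partitions of $I$ into two-element sets) and $D_p=D_{c(j)c(k)}$ for a pair $p=\{j<k\}$. In tensor notation, $\langle\mathfrak a_I\rangle=D_I$. -/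

import Mathlib

noncomputable section

/-- The Hilbert space of `n` bosonic modes, the `n`-fold Hilbert tensor power of `ℓ²(ℕ)`, realized as
`ℓ²(ℕⁿ)`: the coordinate at `k` is the amplitude of the number state with occupation numbers `k`. -/
abbrev FockSpace (n : ℕ) : Type :=
  lp (fun _ : Fin n → ℕ => ℂ) 2

/-- The number state with occupation numbers `k`. -/
def numberState {n : ℕ} (k : Fin n → ℕ) : FockSpace n :=
  lp.single 2 k (1 : ℂ)

/-- The components of the vector `(a₁, …, aₙ, a₁†, …, aₙ†)`: `Sum.inl j` is the annihilation
operator of mode `j`, `Sum.inr j` is the creation operator of mode `j`. -/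
abbrev Ladder (n : ℕ) : Type :=
  Fin n ⊕ Fin n

/-- `(a_j ψ)(k) = √(k_j + 1) ψ(k + e_j)`, on arbitrary sequences of amplitudes. -/
def annihilation {n : ℕ} (j : Fin n) (ψ : (Fin n → ℕ) → ℂ) : (Fin n → ℕ) → ℂ :=
  fun k => (Real.sqrt ((k j : ℝ) + 1) : ℂ) * ψ (k + Pi.single j 1)

/-- `(a_j† ψ)(k) = √(k_j) ψ(k - e_j)`, which is `0` if `k_j = 0`, on arbitrary sequences of
amplitudes. -/
def creation {n : ℕ} (j : Fin n) (ψ : (Fin n → ℕ) → ℂ) : (Fin n → ℕ) → ℂ :=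
  fun k => (Real.sqrt (k j : ℝ) : ℂ) * ψ (k - Pi.single j 1)

/-- The action of the components of `(a₁, …, aₙ, a₁†, …, aₙ†)` on sequences of amplitudes. -/
def ladder {n : ℕ} : Ladder n → ((Fin n → ℕ) → ℂ) → ((Fin n → ℕ) → ℂ) :=
  Sum.elim annihilation creation

/-- The vector `(z₁, …, zₙ, z̄₁, …, z̄ₙ)`. -/
def phaseVec {n : ℕ} (z : Fin n → ℂ) : Ladder n → ℂ :=
  Sum.elim z (fun j => starRingEnd ℂ (z j))

/-- The linear form `∑ᵢ fᵢ 𝔞ᵢ` in the ladder operators, acting on sequences of amplitudes. -/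
def linearForm {n : ℕ} (f : Ladder n → ℂ) (ψ : (Fin n → ℕ) → ℂ) : (Fin n → ℕ) → ℂ :=
  fun k => ∑ i, f i * ladder i ψ k

/-- The graph of the product `𝔞_{i₁} ⋯ 𝔞_{iₘ}` of unbounded operators in the Hilbert space, each
factor being taken on its maximal domain (all square-summable `χ` with square-summable image):
`ψ` lies in the domain of the product and `φ` is its image. -/
def LadderProductGraph {n : ℕ} : List (Ladder n) → FockSpace n → FockSpace n → Prop
  | [], ψ, φ => φ = ψ
  | i :: w, ψ, φ => ∃ χ : FockSpace n, LadderProductGraph w ψ χ ∧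
      (φ : (Fin n → ℕ) → ℂ) = ladder i (χ : (Fin n → ℕ) → ℂ)

/-- The action of the product `𝔞_{i₁} ⋯ 𝔞_{iₘ}` on sequences of amplitudes (the last factor acts
first). -/
def ladderProduct {n : ℕ} (w : List (Ladder n)) (ψ : (Fin n → ℕ) → ℂ) : (Fin n → ℕ) → ℂ :=
  w.foldr ladder ψ

/-- Trace class (nuclear) operators: `T = ∑ₖ |xₖ⟩⟨yₖ|` with `∑ₖ ‖xₖ‖ ‖yₖ‖ < ∞`. -/
def IsTraceClass {n : ℕ} (T : FockSpace n →L[ℂ] FockSpace n) : Prop :=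
  ∃ x y : ℕ → FockSpace n, Summable (fun k => ‖x k‖ * ‖y k‖) ∧
    ∀ ψ : FockSpace n, HasSum (fun k => inner ℂ (y k) ψ • x k) (T ψ)

/-- The trace, computed in the orthonormal basis of number states (for trace class operators the
series converges absolutely). -/
def opTrace {n : ℕ} (T : FockSpace n →L[ℂ] FockSpace n) : ℂ :=
  ∑' k : Fin n → ℕ, inner ℂ (numberState k) (T (numberState k))

/-- States (density operators): positive trace class operators of trace one. -/
structure IsDensityOperator {n : ℕ} (ρ : FockSpace n →L[ℂ] FockSpace n) : Prop where
  isPositive : ρ.IsPositive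
  isTraceClass : IsTraceClass ρ
  trace_eq_one : opTrace ρ = 1

/-- `U` is the strongly continuous one-parameter unitary group `t ↦ e^{i t A}` generated by the
self-adjoint operator `A = ∑ⱼ (zⱼ aⱼ + z̄ⱼ aⱼ†)` with its maximal domain: the infinitesimal
generator of `U` is exactly `i A`. -/
structure IsFieldGroup {n : ℕ} (z : Fin n → ℂ) (U : ℝ → FockSpace n →L[ℂ] FockSpace n) :
    Prop where
  map_zero : U 0 = 1
  map_add : ∀ s t : ℝ, U (s + t) = U s * U t
  mem_unitary : ∀ t : ℝ, U t ∈ unitary (FockSpace n →L[ℂ] FockSpace n)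
  continuous : ∀ ψ : FockSpace n, Continuous (fun t : ℝ => U t ψ)
  generator : ∀ ψ φ : FockSpace n,
    HasDerivAt (fun t : ℝ => U t ψ) (Complex.I • φ) 0 ↔
      (φ : (Fin n → ℕ) → ℂ) = linearForm (phaseVec z) (ψ : (Fin n → ℕ) → ℂ)

/-- `W` is the Weyl operator `e^{i zᵀ𝔞}`, where `zᵀ𝔞 = ∑ⱼ (zⱼ aⱼ + z̄ⱼ aⱼ†)`. -/
def IsWeylOperator {n : ℕ} (z : Fin n → ℂ) (W : FockSpace n →L[ℂ] FockSpace n) : Prop :=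
  ∃ U : ℝ → FockSpace n →L[ℂ] FockSpace n, IsFieldGroup z U ∧ W = U 1

/-- `h` is the value `tr (e^{i zᵀ𝔞} ρ)` at `z` of the characteristic function of `ρ`. -/
def IsCharFunValue {n : ℕ} (ρ : FockSpace n →L[ℂ] FockSpace n) (z : Fin n → ℂ) (h : ℂ) : Prop :=
  ∃ W : FockSpace n →L[ℂ] FockSpace n, IsWeylOperator z W ∧ opTrace (W * ρ) = h

/-- `ρ` is Gaussian with mean `μ` and (symmetric) covariance matrix `C`: its characteristic function
is `exp (μᵀ(i z) + ½ (i z)ᵀ C (i z))`, where `z` stands for `(z₁, …, zₙ, z̄₁, …, z̄ₙ)`. -/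
structure IsGaussian {n : ℕ} (ρ : FockSpace n →L[ℂ] FockSpace n) (μ : Ladder n → ℂ)
    (C : Matrix (Ladder n) (Ladder n) ℂ) : Prop where
  isSymm : C.IsSymm
  charFun : ∀ z : Fin n → ℂ, IsCharFunValue ρ z
    (Complex.exp (μ ⬝ᵥ (Complex.I • phaseVec z) +
      (1 / 2) * ((Complex.I • phaseVec z) ⬝ᵥ C.mulVec (Complex.I • phaseVec z))))

/-- The moment `⟨𝔞_{i₁} ⋯ 𝔞_{iₘ}⟩` in `ρ` exists: `ρ` maps into the domain of the product
`X = 𝔞_{i₁} ⋯ 𝔞_{iₘ}`, and `X ρ` is a trace class operator. -/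
def MomentExists {n : ℕ} (ρ : FockSpace n →L[ℂ] FockSpace n) (w : List (Ladder n)) : Prop :=
  ∃ T : FockSpace n →L[ℂ] FockSpace n,
    (∀ ψ : FockSpace n, LadderProductGraph w (ρ ψ) (T ψ)) ∧ IsTraceClass T

/-- The moment `⟨𝔞_{i₁} ⋯ 𝔞_{iₘ}⟩ = tr (𝔞_{i₁} ⋯ 𝔞_{iₘ} ρ)`, with the trace computed in the basis
of number states. -/
def moment {n : ℕ} (ρ : FockSpace n →L[ℂ] FockSpace n) (w : List (Ladder n)) : ℂ :=
  ∑' k : Fin n → ℕ, ladderProduct w (ρ (numberState k) : (Fin n → ℕ) → ℂ) k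

/-- The matrix of second central moments, `D i j = ⟨𝔞ᵢ 𝔞ⱼ⟩ - ⟨𝔞ᵢ⟩ ⟨𝔞ⱼ⟩`. -/
def secondCentralMoments {n : ℕ} (ρ : FockSpace n →L[ℂ] FockSpace n) :
    Matrix (Ladder n) (Ladder n) ℂ :=
  Matrix.of fun i j => moment ρ [i, j] - moment ρ [i] * moment ρ [j]

/-- The factors of the component `𝔞_{c(j₁)} ⋯ 𝔞_{c(jₘ)}` of the tensor `𝔞_I`, where
`I = {j₁ < ⋯ < jₘ}` and `c j` is the component taken in the tensor factor number `j`. -/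
def indexWord {n : ℕ} (c : ℕ → Ladder n) (I : Finset ℕ) : List (Ladder n) :=
  (I.sort (fun a b => a ≤ b)).map c

/-- The component of `D_p` for a pair `p = {j < k}`, namely `D (c j) (c k)`: the product has
exactly one factor. -/
def pairFactor {n : ℕ} (D : Matrix (Ladder n) (Ladder n) ℂ) (c : ℕ → Ladder n) (p : Finset ℕ) : ℂ :=
  ∏ x ∈ p.offDiag.filter (fun x => x.1 < x.2), D (c x.1) (c x.2)

/-- All pairings of `I`, i.e. partitions of `I` into two-element sets. -/
def pairings (I : Finset ℕ) : Finset (Finpartition I) :=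
  Finset.univ.filter (fun P => ∀ p ∈ P.parts, p.card = 2)

/-- The component of `D_I`: the sum over all pairings of `I` of the products of the `D_p` if `|I|`
is even, and zero if `|I|` is odd. -/
def pairingSum {n : ℕ} (D : Matrix (Ladder n) (Ladder n) ℂ) (c : ℕ → Ladder n) (I : Finset ℕ) : ℂ :=
  if Even I.card then ∑ P ∈ pairings I, ∏ p ∈ P.parts, pairFactor D c p else 0

end

noncomputable section

/-- The linear form `∑ᵢ fᵢ xᵢ` in the generators of the free algebra. -/
def freeForm {X : Type*} [Fintype X] : (X → ℂ) →ₗ[ℂ] FreeAlgebra ℂ X :=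
  Fintype.linearCombination ℂ (FreeAlgebra.ι ℂ)

theorem freeForm_apply {X : Type*} [Fintype X] (f : X → ℂ) :
    freeForm f = ∑ i, f i • FreeAlgebra.ι ℂ i :=
  Fintype.linearCombination_apply ..

theorem freeForm_single {X : Type*} [Fintype X] [DecidableEq X] (i : X) :
    freeForm (Pi.single i 1) = FreeAlgebra.ι ℂ i := by
  simp [freeForm_apply, Pi.single_apply]

/-- A linear functional on the free algebra respects the commutation relations
`[xᵢ, xⱼ] = κᵢⱼ`. -/
def RespectsCommutation {X : Type*} (κ : X → X → ℂ) (φ : FreeAlgebra ℂ X →ₗ[ℂ] ℂ) : Prop :=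
  ∀ (u v : FreeAlgebra ℂ X) (x y : X),
    φ (u * (FreeAlgebra.ι ℂ x * FreeAlgebra.ι ℂ y - FreeAlgebra.ι ℂ y * FreeAlgebra.ι ℂ x) * v) =
      κ x y * φ (u * v)

section

variable {X : Type*} [Fintype X] {κ : X → X → ℂ} {φ : FreeAlgebra ℂ X →ₗ[ℂ] ℂ}

theorem RespectsCommutation.apply_commutator (h : RespectsCommutation κ φ) (u v : FreeAlgebra ℂ X)
    (f g : X → ℂ) :
    φ (u * (freeForm f * freeForm g - freeForm g * freeForm f) * v) =
      (∑ x, ∑ y, f x * g y * κ x y) * φ (u * v) := by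
  have : u * (freeForm f * freeForm g - freeForm g * freeForm f) * v =
      ∑ x, ∑ y, (f x * g y) • (u * (FreeAlgebra.ι ℂ x * FreeAlgebra.ι ℂ y -
        FreeAlgebra.ι ℂ y * FreeAlgebra.ι ℂ x) * v) := by
    simp only [freeForm_apply, Finset.sum_mul_sum]
    conv_lhs => enter [1, 2, 2]; rw [Finset.sum_comm]
    simp only [← Finset.sum_sub_distrib, Finset.mul_sum, Finset.sum_mul]
    refine Finset.sum_congr rfl fun x _ => Finset.sum_congr rfl fun y _ => ?_
    rw [smul_mul_smul_comm, smul_mul_smul_comm, mul_comm (g y), ← smul_sub, mul_smul_comm,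
      smul_mul_assoc]
  rw [this]
  rw [map_sum, Finset.sum_mul]
  refine Finset.sum_congr rfl fun x _ => ?_
  rw [map_sum, Finset.sum_mul]
  refine Finset.sum_congr rfl fun y _ => ?_
  rw [map_smul, h u v, smul_eq_mul, ← mul_assoc]

/-- If `φ` vanishes on shorter products, it is invariant under permutations of the factors. -/
theorem RespectsCommutation.perm (h : RespectsCommutation κ φ) {m : ℕ}
    (hm : ∀ l : List (X → ℂ), l.length < m → φ (l.map freeForm).prod = 0)
    {l l' : List (X → ℂ)} (hl : l.Perm l') : ∀ u : List (X → ℂ), (u ++ l).length = m →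
      φ ((u ++ l).map freeForm).prod = φ ((u ++ l').map freeForm).prod := by
  induction hl with
  | nil => intros; rfl
  | cons x _ ih =>
    intro u hu
    simpa using ih (u ++ [x]) (by simpa using hu)
  | swap x y l =>
    intro u hu
    -- The two orders differ by a scalar times a product with two factors fewer, which `φ` kills.
    have h1 := h.apply_commutator (u.map freeForm).prod (l.map freeForm).prod y x
    have h2 := hm (u ++ l) (by simp at hu ⊢; omega)
    rw [List.map_append, List.prod_append] at h2
    rw [h2, mul_zero, mul_sub, sub_mul, map_sub, sub_eq_zero] at h1
    simpa [mul_assoc] using h1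
  | trans h1 _ ih1 ih2 =>
    intro u hu
    rw [ih1 u hu, ih2 u (by rw [← hu]; simp [h1.length_eq])]

/-- Under `φ` the factors of a product of top length `m` commute, so the binomial theorem survives.
The tail `u` makes the induction work: one factor of the power is split and absorbed into it. -/
theorem RespectsCommutation.binomial (h : RespectsCommutation κ φ) {m : ℕ}
    (hm : ∀ l : List (X → ℂ), l.length < m → φ (l.map freeForm).prod = 0)
    (f g : X → ℂ) (t : ℂ) (j : ℕ) : ∀ u : List (X → ℂ), j + u.length = m →
      φ (freeForm (f + t • g) ^ j * (u.map freeForm).prod) =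
        ∑ i ∈ Finset.range (j + 1), t ^ i * (j.choose i *
          φ (freeForm f ^ (j - i) * freeForm g ^ i *
            (u.map freeForm).prod)) := by
  induction j with
  | zero => intro u _; simp
  | succ j ih =>
    intro u hu
    have hf := ih (f :: u) (by simp; omega)
    have hg := ih (g :: u) (by simp; omega)
    have e : freeForm (f + t • g) ^ (j + 1) * (u.map freeForm).prod =
        freeForm (f + t • g) ^ j * ((f :: u).map freeForm).prod +
        t • (freeForm (f + t • g) ^ j * ((g :: u).map freeForm).prod) := by
      rw [pow_succ, mul_assoc, map_add _ f, map_smul]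
      simp [add_mul, mul_add]
    have hf' : ∀ i ∈ Finset.range (j + 1),
        φ (freeForm f ^ (j - i) * freeForm g ^ i *
          ((f :: u).map freeForm).prod) =
        φ (freeForm f ^ (j + 1 - i) * freeForm g ^ i *
          (u.map freeForm).prod) := by
      intro i hi
      rw [Finset.mem_range] at hi
      have := h.perm hm (l := List.replicate i g ++ f :: u) (l' := f :: (List.replicate i g ++ u))
        List.perm_middle (List.replicate (j - i) f) (by simp; omega)
      rw [show j + 1 - i = j - i + 1 by omega, pow_succ]
      simpa [mul_assoc] using this
    have hg' : ∀ i, φ (freeForm f ^ (j - i) * freeForm g ^ i *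
          ((g :: u).map freeForm).prod) =
        φ (freeForm f ^ (j + 1 - (i + 1)) * freeForm g ^ (i + 1) *
          (u.map freeForm).prod) := by
      intro i
      simp [pow_succ, mul_assoc]
    rw [e, map_add, map_smul, hf, hg, Finset.sum_range_succ' _ (j + 1)]
    simp only [Nat.choose_succ_succ, hg', smul_eq_mul]
    rw [Finset.sum_congr rfl fun i hi => by rw [hf' i hi], Finset.sum_range_succ']
    push_cast
    simp only [add_mul, mul_add, Finset.sum_add_distrib, Finset.mul_sum]
    rw [Finset.sum_range_succ (fun i => t ^ (i + 1) * (((j.choose (i + 1) : ℕ) : ℂ) * _))]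
    simp only [pow_succ, Nat.choose_succ_self]
    simp only [Nat.cast_zero, zero_mul, mul_zero, add_zero, Nat.choose_zero_right, mul_assoc,
      mul_left_comm t]
    ring_nf

end

/-- The vectors `phaseVec z` are the fixed points of the conjugation that swaps the two halves, a
real form of `Ladder n → ℂ`. -/
theorem exists_phaseVec_add {n : ℕ} (f : Ladder n → ℂ) :
    ∃ y z : Fin n → ℂ, f = phaseVec y + Complex.I • phaseVec z := by
  refine ⟨fun j => (f (Sum.inl j) + starRingEnd ℂ (f (Sum.inr j))) / 2,
    fun j => (f (Sum.inl j) - starRingEnd ℂ (f (Sum.inr j))) / (2 * Complex.I), ?_⟩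
  funext i
  rcases i with j | j
  · simp only [phaseVec, Pi.add_apply, Pi.smul_apply, Sum.elim_inl, smul_eq_mul]
    field_simp [Complex.I_ne_zero]
    ring
  · simp only [phaseVec, Pi.add_apply, Pi.smul_apply, Sum.elim_inr, smul_eq_mul, map_div₀, map_add,
      map_sub, map_mul, Complex.conj_conj, Complex.conj_I, map_ofNat]
    field_simp [Complex.I_ne_zero]
    ring

theorem phaseVec_add_smul {n : ℕ} (y z : Fin n → ℂ) (t : ℝ) :
    phaseVec (y + (t : ℂ) • z) = phaseVec y + (t : ℂ) • phaseVec z := by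
  funext i
  rcases i with j | j <;> simp [phaseVec]

theorem eq_zero_of_forall_real_sum_eq_zero {m : ℕ} {c : ℕ → ℂ}
    (h : ∀ t : ℝ, ∑ i ∈ Finset.range (m + 1), (t : ℂ) ^ i * c i = 0) {i : ℕ} (hi : i ≤ m) :
    c i = 0 := by
  have hp : (∑ i ∈ Finset.range (m + 1), Polynomial.monomial i (c i) : Polynomial ℂ) = 0 := by
    refine Polynomial.eq_zero_of_infinite_isRoot _
      ((Set.infinite_range_of_injective Complex.ofReal_injective).mono ?_)
    rintro _ ⟨t, rfl⟩
    simp only [Set.mem_ofPred_eq, Polynomial.IsRoot.def, Polynomial.eval_finsetSum,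
      Polynomial.eval_monomial]
    rw [← h t]
    exact Finset.sum_congr rfl fun i _ => mul_comm _ _
  have := congrArg (fun p => Polynomial.coeff p i) hp
  simpa [Polynomial.finsetSum_coeff, Polynomial.coeff_monomial, Nat.lt_succ_iff, hi] using this

/-- Polarization, by induction on the number of factors: below the top length everything vanishes,
so order is irrelevant. The inner induction trades the factors of a power of a real field operator,
one at a time, for arbitrary linear forms. -/
theorem RespectsCommutation.eq_zero {n : ℕ} {κ : Ladder n → Ladder n → ℂ}
    {φ : FreeAlgebra ℂ (Ladder n) →ₗ[ℂ] ℂ} (h : RespectsCommutation κ φ)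
    (hφ : ∀ z m, φ (freeForm (phaseVec z) ^ m) = 0) : φ = 0 := by
  have key : ∀ m, ∀ l : List (Ladder n → ℂ), l.length = m →
      φ (l.map freeForm).prod = 0 := by
    intro m
    induction m using Nat.strong_induction_on with
    | _ m ih =>
      have hm : ∀ l : List (Ladder n → ℂ), l.length < m → φ (l.map freeForm).prod = 0 :=
        fun l hl => ih _ hl l rfl
      have aux : ∀ u : List (Ladder n → ℂ), u.length ≤ m → ∀ z,
          φ (freeForm (phaseVec z) ^ (m - u.length) * (u.map freeForm).prod) = 0 := by
        intro u
        induction u with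
        | nil => intro _ z; simpa using hφ z m
        | cons f u ihu =>
          intro hu z
          simp only [List.length_cons] at hu
          obtain ⟨k, hk⟩ : ∃ k, m = k + 1 + u.length := ⟨m - u.length - 1, by omega⟩
          have hreal : ∀ y, φ (freeForm (phaseVec z) ^ k * freeForm (phaseVec y) *
              (u.map freeForm).prod) = 0 := by
            intro y
            have h0 : ∀ t : ℝ, ∑ i ∈ Finset.range (k + 1 + 1), (t : ℂ) ^ i * ((k + 1).choose i *
                φ (freeForm (phaseVec z) ^ (k + 1 - i) * freeForm (phaseVec y) ^ i *
                (u.map freeForm).prod)) = 0 := by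
              intro t
              rw [← h.binomial hm _ _ _ _ u hk.symm, ← phaseVec_add_smul]
              have := ihu (by omega) (z + (t : ℂ) • y)
              rwa [show m - u.length = k + 1 by omega] at this
            -- The coefficient of `t` is `k + 1` times the product with a single factor replaced.
            -- Only real `t` are available, because `phaseVec` is merely real linear.
            have := eq_zero_of_forall_real_sum_eq_zero h0 (i := 1) (by omega)
            rw [mul_eq_zero] at this
            rcases this with h1 | h1
            · norm_cast at h1
              simp at h1
            · simpa using h1
          obtain ⟨y, y', rfl⟩ := exists_phaseVec_add f
          rw [List.length_cons, show m - (u.length + 1) = k by omega, List.map_cons,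
            List.prod_cons, map_add _ (phaseVec y), map_smul, ← mul_assoc, mul_add, add_mul, map_add,
            hreal, mul_smul_comm, smul_mul_assoc, map_smul, hreal, smul_zero, add_zero]
      intro l hl
      -- With all factors traded, the remaining power has exponent `0` and the choice of `z` is
      -- immaterial.
      have := aux l hl.le 0
      simpa [hl] using this
  ext P
  have hP : P ∈ Submodule.span ℂ (Submonoid.closure
      (Set.range (FreeAlgebra.ι ℂ : Ladder n → _)) : Set (FreeAlgebra ℂ (Ladder n))) := by
    rw [← Algebra.adjoin_eq_span, FreeAlgebra.adjoin_range_ι]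
    exact Submodule.mem_top
  refine (Submodule.span_le (p := LinearMap.ker φ)).2 ?_ hP
  intro w hw
  obtain ⟨l, hl, rfl⟩ := Submonoid.exists_list_of_mem_closure hw
  obtain ⟨l', rfl⟩ : ∃ l' : List (Ladder n), l'.map (FreeAlgebra.ι ℂ) = l := by
    rw [← Set.mem_range, Set.range_list_map]
    exact hl
  have := key _ (l'.map fun i => Pi.single i 1) rfl
  rw [List.map_map] at this
  rw [SetLike.mem_coe, LinearMap.mem_ker, ← this]
  congr 3
  funext i
  exact (freeForm_single i).symm

/-- A subspace of the free algebra that is compatible with the commutation relations and contains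
the powers of all real field operators contains everything. -/
theorem submodule_eq_top_of_pow_mem {n : ℕ} {κ : Ladder n → Ladder n → ℂ}
    {N : Submodule ℂ (FreeAlgebra ℂ (Ladder n))}
    (h : ∀ (u v : FreeAlgebra ℂ (Ladder n)) (x y : Ladder n),
      u * (FreeAlgebra.ι ℂ x * FreeAlgebra.ι ℂ y - FreeAlgebra.ι ℂ y * FreeAlgebra.ι ℂ x) * v -
        κ x y • (u * v) ∈ N)
    (hN : ∀ z m, freeForm (phaseVec z) ^ m ∈ N) : N = ⊤ := by
  rw [eq_top_iff]
  intro P _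
  by_contra hP
  obtain ⟨φ, hφ, hle⟩ := Submodule.exists_le_ker_of_notMem hP
  refine hφ ?_
  have : RespectsCommutation κ φ := by
    intro u v x y
    have := hle (h u v x y)
    rwa [LinearMap.mem_ker, map_sub, sub_eq_zero, map_smul] at this
  rw [this.eq_zero fun z m => hle (hN z m), LinearMap.zero_apply]

/-! ### The Wick functional -/

/-- The derivation `∑ x y, f x * D x y • ∂_y` of the polynomial algebra. -/
def wickDerivation {X : Type*} [Fintype X] (D : Matrix X X ℂ) (f : X → ℂ) :
    Derivation ℂ (MvPolynomial X ℂ) (MvPolynomial X ℂ) :=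
  MvPolynomial.mkDerivation ℂ fun y => MvPolynomial.C (∑ x, f x * D x y)

/-- The representation of the free algebra on polynomials in which the generator `x` acts as
`X_x + ∑ y, D x y • ∂_y`. -/
def wickRep {X : Type*} [Fintype X] (D : Matrix X X ℂ) :
    FreeAlgebra ℂ X →ₐ[ℂ] Module.End ℂ (MvPolynomial X ℂ) :=
  FreeAlgebra.lift ℂ fun x => LinearMap.mulLeft ℂ (MvPolynomial.X x) +
    (MvPolynomial.mkDerivation ℂ fun y => MvPolynomial.C (D x y)).toLinearMap

/-- The Wick functional: the constant coefficient of `P` acting on the polynomial `1`. -/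
def wick {X : Type*} [Fintype X] (D : Matrix X X ℂ) : FreeAlgebra ℂ X →ₗ[ℂ] ℂ where
  toFun P := MvPolynomial.constantCoeff (wickRep D P 1)
  map_add' P Q := by simp
  map_smul' c P := by simp [MvPolynomial.smul_eq_C_mul]

section

variable {X : Type*} [Fintype X] (D : Matrix X X ℂ)

theorem wick_apply (P : FreeAlgebra ℂ X) :
    wick D P = MvPolynomial.constantCoeff (wickRep D P 1) := rfl

theorem wick_one : wick D 1 = 1 := by simp [wick_apply]

theorem wickDerivation_apply (f : X → ℂ) (p : MvPolynomial X ℂ) :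
    wickDerivation D f p =
      ∑ x, f x • MvPolynomial.mkDerivation ℂ (fun y => MvPolynomial.C (D x y)) p := by
  have : wickDerivation D f =
      ∑ x, f x • MvPolynomial.mkDerivation ℂ (fun y => MvPolynomial.C (D x y)) := by
    refine MvPolynomial.derivation_ext fun i => ?_
    rw [← Derivation.coeFnAddMonoidHom_apply (∑ x, _), map_sum, Finset.sum_apply]
    simp only [Derivation.coeFnAddMonoidHom_apply, Derivation.smul_apply, wickDerivation,
      MvPolynomial.mkDerivation_X, map_sum, MvPolynomial.smul_eq_C_mul, map_mul]
  rw [this, ← Derivation.coeFnAddMonoidHom_apply, map_sum, Finset.sum_apply]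
  rfl

theorem wickRep_freeForm (f : X → ℂ) (p : MvPolynomial X ℂ) :
    wickRep D (freeForm f) p =
      (∑ x, f x • MvPolynomial.X x) * p + wickDerivation D f p := by
  rw [wickDerivation_apply, freeForm_apply, map_sum, LinearMap.sum_apply, Finset.sum_mul,
    ← Finset.sum_add_distrib]
  refine Finset.sum_congr rfl fun x _ => ?_
  rw [map_smul, LinearMap.smul_apply, wickRep, FreeAlgebra.lift_ι_apply, LinearMap.add_apply,
    LinearMap.mulLeft_apply, smul_add, smul_mul_assoc]
  rfl

theorem wickDerivation_linear (f g : X → ℂ) :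
    wickDerivation D f (∑ x, g x • MvPolynomial.X x) =
      MvPolynomial.C (∑ x, ∑ y, f x * g y * D x y) := by
  rw [map_sum, Finset.sum_comm, map_sum]
  refine Finset.sum_congr rfl fun y _ => ?_
  rw [Derivation.map_smul, wickDerivation, MvPolynomial.mkDerivation_X, MvPolynomial.smul_eq_C_mul,
    ← map_mul, Finset.mul_sum]
  congr 1
  exact Finset.sum_congr rfl fun x _ => by ring

/-- Derivations with constant coefficients commute, so moving one past a generator costs only a
scalar: the contraction of `f` with `g`. -/
theorem wickDerivation_wickRep (f g : X → ℂ) (p : MvPolynomial X ℂ) :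
    wickDerivation D f (wickRep D (freeForm g) p) =
      wickRep D (freeForm g) (wickDerivation D f p) + (∑ x, ∑ y, f x * g y * D x y) • p := by
  have hcomm : wickDerivation D f (wickDerivation D g p) =
      wickDerivation D g (wickDerivation D f p) := by
    have : ⁅wickDerivation D f, wickDerivation D g⁆ = 0 := by
      refine MvPolynomial.derivation_ext fun i => ?_
      simp [Derivation.commutator_apply, wickDerivation]
    rw [← sub_eq_zero, ← Derivation.commutator_apply, this, Derivation.zero_apply]
  rw [wickRep_freeForm, wickRep_freeForm, map_add, Derivation.leibniz, wickDerivation_linear, hcomm,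
    MvPolynomial.smul_eq_C_mul, smul_eq_mul, smul_eq_mul]
  ring

/-- Multiplication by a linear form leaves no constant coefficient, so only the derivation part of
the leftmost factor survives. -/
theorem wick_freeForm_mul (f : X → ℂ) (P : FreeAlgebra ℂ X) :
    wick D (freeForm f * P) = MvPolynomial.constantCoeff (wickDerivation D f (wickRep D P 1)) := by
  rw [wick_apply, map_mul, Module.End.mul_apply, wickRep_freeForm, map_add, map_mul]
  simp [MvPolynomial.smul_eq_C_mul]

theorem wickDerivation_wickRep_pow (f : X → ℂ) (m : ℕ) :
    wickDerivation D f (wickRep D (freeForm f ^ (m + 1)) 1) =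
      ((m + 1 : ℂ) * ∑ x, ∑ y, f x * f y * D x y) • wickRep D (freeForm f ^ m) 1 := by
  induction m with
  | zero => rw [pow_one, wickDerivation_wickRep]; simp
  | succ m ih =>
    rw [pow_succ', map_mul, Module.End.mul_apply, wickDerivation_wickRep, ih, map_smul,
      ← Module.End.mul_apply, ← map_mul, ← pow_succ', ← add_smul]
    push_cast
    congr 1
    ring

/-- The first factor can be contracted with any of the `m + 1` others, with the same weight each
time. This matches the moment recursion of a centred Gaussian. -/
theorem wick_pow (f : X → ℂ) (m : ℕ) :
    wick D (freeForm f ^ (m + 2)) =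
      (m + 1) * (∑ x, ∑ y, f x * f y * D x y) * wick D (freeForm f ^ m) := by
  rw [pow_succ', wick_freeForm_mul, wickDerivation_wickRep_pow, wick_apply,
    MvPolynomial.smul_eq_C_mul, map_mul, MvPolynomial.constantCoeff_C]

theorem wick_freeForm (f : X → ℂ) : wick D (freeForm f) = 0 := by
  rw [← mul_one (freeForm f), wick_freeForm_mul]
  simp

theorem wickRep_commutator (x y : X) :
    wickRep D (FreeAlgebra.ι ℂ x * FreeAlgebra.ι ℂ y - FreeAlgebra.ι ℂ y * FreeAlgebra.ι ℂ x) =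
      (D x y - D y x) • 1 := by
  classical
  refine LinearMap.ext fun p => ?_
  have h1 := wickDerivation_wickRep D (Pi.single x 1) (Pi.single y 1) p
  rw [wickRep_freeForm, wickRep_freeForm] at h1
  rw [← freeForm_single, ← freeForm_single]
  simp only [map_sub, map_mul, LinearMap.sub_apply, Module.End.mul_apply, LinearMap.smul_apply,
    Module.End.one_apply]
  simp only [wickRep_freeForm, map_add, Derivation.leibniz, wickDerivation_linear] at h1 ⊢
  simp [Pi.single_apply, sub_smul, MvPolynomial.smul_eq_C_mul] at h1 ⊢
  linear_combination h1

theorem wick_respectsCommutation : RespectsCommutation (fun x y => D x y - D y x) (wick D) := by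
  intro u v x y
  rw [wick_apply, map_mul, map_mul, wickRep_commutator, wick_apply, map_mul]
  simp [MvPolynomial.smul_eq_C_mul]

theorem wick_ι_mul_ι (x y : X) : wick D (FreeAlgebra.ι ℂ x * FreeAlgebra.ι ℂ y) = D x y := by
  classical
  rw [← freeForm_single, ← freeForm_single, wick_freeForm_mul, ← mul_one (freeForm (Pi.single y 1)),
    map_mul, Module.End.mul_apply, wickDerivation_wickRep]
  simp [Pi.single_apply, MvPolynomial.smul_eq_C_mul]

end

/-! ### Words and pairings -/

theorem indexWord_eq_cons {n : ℕ} (c : ℕ → Ladder n) {a : ℕ} {s : Finset ℕ}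
    (h : ∀ b ∈ s, a < b) : indexWord c (insert a s) = c a :: indexWord c s := by
  rw [indexWord, Finset.sort_insert _ (fun b hb => (h b hb).le) fun ha => lt_irrefl _ (h a ha)]
  rfl

/-- The product of the generators along a word. -/
def wordProd {X : Type*} (w : List X) : FreeAlgebra ℂ X :=
  (w.map (FreeAlgebra.ι ℂ)).prod

/-- The derivation passes through the word and is contracted with each letter in turn; at the end it
annihilates `1`. Adding elements at the minimum adds letters at the head of the sorted word. -/
theorem wickDerivation_wordProd {n : ℕ} (D : Matrix (Ladder n) (Ladder n) ℂ) (x : Ladder n)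
    (c : ℕ → Ladder n) (s : Finset ℕ) :
    wickDerivation D (Pi.single x 1) (wickRep D (wordProd (indexWord c s)) 1) =
      ∑ k ∈ s, D x (c k) • wickRep D (wordProd (indexWord c (s.erase k))) 1 := by
  induction s using Finset.induction_on_min with
  | empty => simp [wordProd, indexWord]
  | insert a s h ih =>
    have ha : a ∉ s := fun ha => lt_irrefl _ (h a ha)
    have hw : ∀ t : Finset ℕ, (∀ b ∈ t, a < b) → wickRep D (wordProd (indexWord c (insert a t))) 1 =
        wickRep D (freeForm (Pi.single (c a) 1)) (wickRep D (wordProd (indexWord c t)) 1) := by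
      intro t ht
      rw [indexWord_eq_cons c ht, freeForm_single, ← Module.End.mul_apply, ← map_mul]
      simp [wordProd]
    rw [hw s h, wickDerivation_wickRep, ih, Finset.sum_insert ha, Finset.erase_insert ha, map_sum,
      add_comm]
    congr 1
    · simp [Pi.single_apply]
    · refine Finset.sum_congr rfl fun k hk => ?_
      have hka : a ≠ k := fun e => ha (e ▸ hk)
      rw [map_smul, Finset.erase_insert_of_ne hka,
        hw _ fun b hb => h b (Finset.mem_of_mem_erase hb)]

theorem wick_wordProd_insert {n : ℕ} (D : Matrix (Ladder n) (Ladder n) ℂ)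
    (c : ℕ → Ladder n) {a : ℕ} {s : Finset ℕ} (h : ∀ b ∈ s, a < b) :
    wick D (wordProd (indexWord c (insert a s))) =
      ∑ k ∈ s, D (c a) (c k) * wick D (wordProd (indexWord c (s.erase k))) := by
  rw [indexWord_eq_cons c h, wordProd, List.map_cons, List.prod_cons, ← freeForm_single,
    wick_freeForm_mul, ← wordProd, wickDerivation_wordProd, map_sum]
  exact Finset.sum_congr rfl fun k _ => by simp [wick_apply, MvPolynomial.smul_eq_C_mul]

/-- `S` is the set of parts of a pairing of `I`. -/
def IsPairing (S : Finset (Finset ℕ)) (I : Finset ℕ) : Prop :=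
  (∀ p ∈ S, p.card = 2) ∧ (∀ p ∈ S, ∀ q ∈ S, p ≠ q → Disjoint p q) ∧ ∀ x, x ∈ I ↔ ∃ p ∈ S, x ∈ p

/-- Working with sets of parts avoids comparing partitions of different sets, whose types differ. -/
theorem mem_image_parts_pairings {I : Finset ℕ} {S : Finset (Finset ℕ)} :
    S ∈ (pairings I).image Finpartition.parts ↔ IsPairing S I := by
  simp only [Finset.mem_image, pairings, Finset.mem_filter, Finset.mem_univ, true_and]
  constructor
  · rintro ⟨P, hP, rfl⟩
    refine ⟨hP, fun p hp q hq => P.disjoint hp hq, fun x => ?_⟩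
    conv_lhs => rw [← P.sup_parts]
    simp [Finset.mem_sup]
  · rintro ⟨h1, h2, h3⟩
    refine ⟨⟨S, ?_, ?_, ?_⟩, h1, rfl⟩
    · rw [Finset.supIndep_iff_pairwiseDisjoint]
      exact fun p hp q hq => h2 p hp q hq
    · ext x
      simp [Finset.mem_sup, h3 x]
    · intro h
      simpa using h1 _ h

theorem sum_pairings {I : Finset ℕ} (f : Finset ℕ → ℂ) :
    ∑ P ∈ pairings I, ∏ p ∈ P.parts, f p =
      ∑ S ∈ (pairings I).image Finpartition.parts, ∏ p ∈ S, f p := by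
  rw [Finset.sum_image]
  intro P _ Q _ h
  exact Finpartition.ext h

theorem IsPairing.insert_pair {S : Finset (Finset ℕ)} {s : Finset ℕ} {a k : ℕ} (ha : a ∉ s)
    (hk : k ∈ s) (h : IsPairing S (s.erase k)) : IsPairing (insert {a, k} S) (insert a s) := by
  have hak : a ≠ k := fun e => ha (e ▸ hk)
  have hd : ∀ p ∈ S, Disjoint {a, k} p := by
    intro p hp
    have hsub : ∀ x ∈ p, x ∈ s.erase k := fun x hx => (h.2.2 x).2 ⟨p, hp, hx⟩
    rw [Finset.disjoint_left]
    intro x hx hxp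
    have := hsub x hxp
    grind
  refine ⟨?_, ?_, fun x => ?_⟩
  · intro p hp
    rcases Finset.mem_insert.1 hp with rfl | hp
    · exact Finset.card_pair hak
    · exact h.1 p hp
  · intro p hp q hq hpq
    rcases Finset.mem_insert.1 hp with rfl | hp <;> rcases Finset.mem_insert.1 hq with rfl | hq
    · exact absurd rfl hpq
    · exact hd q hq
    · exact (hd p hp).symm
    · exact h.2.1 p hp q hq hpq
  · have := h.2.2 x
    simp only [Finset.mem_insert, exists_eq_or_imp, ← this, Finset.mem_singleton, Finset.mem_erase]
    grind

theorem IsPairing.exists_eq_insert {S : Finset (Finset ℕ)} {s : Finset ℕ} {a : ℕ} (ha : a ∉ s)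
    (h : IsPairing S (insert a s)) :
    ∃ k ∈ s, ∃ S', IsPairing S' (s.erase k) ∧ insert {a, k} S' = S := by
  obtain ⟨p, hp, hap⟩ := (h.2.2 a).1 (Finset.mem_insert_self a s)
  obtain ⟨k, hk, rfl⟩ : ∃ k, a ≠ k ∧ p = {a, k} := by
    obtain ⟨x, y, hxy, rfl⟩ := Finset.card_eq_two.1 (h.1 p hp)
    rcases Finset.mem_insert.1 hap with rfl | h'
    · exact ⟨y, hxy, rfl⟩
    · rw [Finset.mem_singleton] at h'
      subst h'
      exact ⟨x, hxy.symm, Finset.pair_comm _ _⟩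
  have hks : k ∈ s := by
    have := (h.2.2 k).2 ⟨_, hp, by simp⟩
    exact Finset.mem_of_mem_insert_of_ne this hk.symm
  refine ⟨k, hks, S.erase {a, k}, ⟨fun q hq => h.1 q (Finset.mem_of_mem_erase hq),
    fun q hq r hr => h.2.1 q (Finset.mem_of_mem_erase hq) r (Finset.mem_of_mem_erase hr),
    fun x => ?_⟩, Finset.insert_erase hp⟩
  constructor
  · intro hx
    obtain ⟨q, hq, hxq⟩ := (h.2.2 x).1 (Finset.mem_insert_of_mem (Finset.mem_of_mem_erase hx))
    refine ⟨q, Finset.mem_erase.2 ⟨?_, hq⟩, hxq⟩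
    rintro rfl
    grind
  · rintro ⟨q, hq, hxq⟩
    have hq' := Finset.mem_erase.1 hq
    have hx := (h.2.2 x).2 ⟨q, hq'.2, hxq⟩
    have hd := Finset.disjoint_left.1 (h.2.1 q hq'.2 _ hp hq'.1) hxq
    grind

/-- A pairing amounts to the partner `k` of `a` together with a pairing of what is left. -/
theorem sum_pairings_insert {a : ℕ} {s : Finset ℕ} (ha : a ∉ s) (f : Finset ℕ → ℂ) :
    ∑ P ∈ pairings (insert a s), ∏ p ∈ P.parts, f p =
      ∑ k ∈ s, f {a, k} * ∑ P ∈ pairings (s.erase k), ∏ p ∈ P.parts, f p := by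
  simp only [sum_pairings, Finset.mul_sum]
  rw [Finset.sum_sigma']
  symm
  have hnot : ∀ {k k' : ℕ} {S : Finset (Finset ℕ)}, IsPairing S (s.erase k) → {a, k'} ∉ S := by
    intro k k' S hS hmem
    have := (hS.2.2 a).2 ⟨_, hmem, by simp⟩
    exact ha (Finset.mem_of_mem_erase this)
  refine Finset.sum_bij (fun x _ => insert {a, x.1} x.2) ?_ ?_ ?_ ?_
  · rintro ⟨k, S⟩ h
    rw [Finset.mem_sigma, mem_image_parts_pairings] at h
    exact mem_image_parts_pairings.2 (h.2.insert_pair ha h.1)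
  · rintro ⟨k, S⟩ h ⟨k', S'⟩ h' e
    rw [Finset.mem_sigma, mem_image_parts_pairings] at h h'
    simp only at h h' e
    have hk : k = k' := by
      have h1 : ({a, k} : Finset ℕ) ∈ insert {a, k'} S' := e ▸ Finset.mem_insert_self _ _
      rcases Finset.mem_insert.1 h1 with h2 | h2
      · have h3 : k ∈ ({a, k'} : Finset ℕ) := h2 ▸ by simp
        have hak : k ≠ a := fun e => ha (e ▸ h.1)
        simpa [hak] using h3
      · exact absurd h2 (hnot h'.2)
    subst hk
    have : S = S' := by
      rw [← Finset.erase_insert (hnot (k' := k) h.2), e, Finset.erase_insert (hnot h'.2)]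
    rw [this]
  · intro S hS
    obtain ⟨k, hk, S', hS', e⟩ := (mem_image_parts_pairings.1 hS).exists_eq_insert ha
    exact ⟨⟨k, S'⟩, Finset.mem_sigma.2 ⟨hk, mem_image_parts_pairings.2 hS'⟩, e⟩
  · rintro ⟨k, S⟩ h
    rw [Finset.mem_sigma, mem_image_parts_pairings] at h
    exact (Finset.prod_insert (hnot h.2)).symm

/-- A set of odd size has no pairings, so the parity test is redundant. -/
theorem pairingSum_eq {n : ℕ} (D : Matrix (Ladder n) (Ladder n) ℂ) (c : ℕ → Ladder n)
    (I : Finset ℕ) :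
    pairingSum D c I = ∑ P ∈ pairings I, ∏ p ∈ P.parts, pairFactor D c p := by
  rw [pairingSum]
  split_ifs with h
  · rfl
  · rw [Finset.sum_eq_zero]
    intro P hP
    refine absurd ?_ h
    rw [← P.sum_card_parts, Finset.sum_congr rfl (Finset.mem_filter.1 hP).2]
    simp

theorem pairFactor_pair {n : ℕ} (D : Matrix (Ladder n) (Ladder n) ℂ) (c : ℕ → Ladder n)
    {a k : ℕ} (h : a < k) : pairFactor D c {a, k} = D (c a) (c k) := by
  have : ({a, k} : Finset ℕ).offDiag.filter (fun x => x.1 < x.2) = {(a, k)} := by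
    ext ⟨x, y⟩
    simp only [Finset.mem_filter, Finset.mem_offDiag, Finset.mem_insert, Finset.mem_singleton,
      Prod.mk.injEq]
    omega
  rw [pairFactor, this, Finset.prod_singleton]

/-- Both sides obey the same recursion on the smallest index; its minimality puts the arguments of
`D` in the right order. -/
theorem wick_wordProd_indexWord {n : ℕ} (D : Matrix (Ladder n) (Ladder n) ℂ) (c : ℕ → Ladder n)
    (I : Finset ℕ) : wick D (wordProd (indexWord c I)) = pairingSum D c I := by
  induction I using Finset.strongInduction with
  | H I ih =>
    rcases I.eq_empty_or_nonempty with rfl | hI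
    · rw [pairingSum_eq]
      have : ∀ S, S ∈ (pairings ∅).image Finpartition.parts ↔ S ∈ ({∅} : Finset _) := by
        intro S
        rw [mem_image_parts_pairings, Finset.mem_singleton]
        constructor
        · intro h
          refine Finset.eq_empty_of_forall_notMem fun p hp => ?_
          obtain ⟨x, hx⟩ := Finset.card_pos.1 (by rw [h.1 p hp]; norm_num)
          simpa using (h.2.2 x).2 ⟨p, hp, hx⟩
        · rintro rfl
          simp [IsPairing]
      rw [sum_pairings, Finset.ext this]
      simp [indexWord, wordProd, wick_one]
    · have ha := I.min'_mem hI
      have hlt : ∀ b ∈ I.erase (I.min' hI), I.min' hI < b := fun b hb =>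
        I.min'_lt_of_mem_erase_min' hI hb
      have hss : I.erase (I.min' hI) ⊂ I := Finset.erase_ssubset ha
      rw [← Finset.insert_erase ha, wick_wordProd_insert D c hlt, pairingSum_eq,
        sum_pairings_insert (Finset.notMem_erase _ _)]
      refine Finset.sum_congr rfl fun k hk => ?_
      rw [pairFactor_pair D c (hlt k hk), ← pairingSum_eq,
        ih _ ((Finset.erase_subset _ _).trans_ssubset hss)]

/-! ### Ladder operators on sequences and the canonical commutation relations -/

/-- The ladder operators as linear maps on arbitrary sequences of amplitudes. -/
def ladderEnd {n : ℕ} (i : Ladder n) : Module.End ℂ ((Fin n → ℕ) → ℂ) where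
  toFun := ladder i
  map_add' ψ φ := by
    rcases i with j | j <;> funext k <;> simp [ladder, annihilation, creation, mul_add]
  map_smul' c ψ := by
    rcases i with j | j <;> funext k <;> simp [ladder, annihilation, creation, mul_left_comm]

/-- The action of noncommutative polynomials in the ladder operators on arbitrary sequences of
amplitudes. -/
def ladderRep {n : ℕ} :
    FreeAlgebra ℂ (Ladder n) →ₐ[ℂ] Module.End ℂ ((Fin n → ℕ) → ℂ) :=
  FreeAlgebra.lift ℂ ladderEnd

theorem ladderRep_ι {n : ℕ} (i : Ladder n) : ladderRep (FreeAlgebra.ι ℂ i) = ladderEnd i := by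
  simp [ladderRep]

theorem ladderRep_freeForm {n : ℕ} (f : Ladder n → ℂ) (ψ : (Fin n → ℕ) → ℂ) :
    ladderRep (freeForm f) ψ = linearForm f ψ := by
  funext k
  rw [freeForm_apply]
  simp only [map_sum, map_smul, ladderRep_ι, LinearMap.sum_apply, LinearMap.smul_apply,
    Finset.sum_apply, Pi.smul_apply, smul_eq_mul, linearForm]
  rfl

theorem ladderRep_wordProd {n : ℕ} (w : List (Ladder n)) (ψ : (Fin n → ℕ) → ℂ) :
    ladderRep (wordProd w) ψ = ladderProduct w ψ := by
  induction w with
  | nil => simp [wordProd, ladderProduct]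
  | cons i w ih =>
    rw [wordProd, List.map_cons, List.prod_cons, map_mul, Module.End.mul_apply, ← wordProd, ih,
      ladderRep_ι]
    rfl

theorem annihilation_comm {n : ℕ} (i j : Fin n) (ψ : (Fin n → ℕ) → ℂ) :
    annihilation i (annihilation j ψ) = annihilation j (annihilation i ψ) := by
  rcases eq_or_ne i j with rfl | h
  · rfl
  funext k
  simp only [annihilation, Pi.add_apply, Pi.single_eq_of_ne h, Pi.single_eq_of_ne h.symm, add_zero]
  rw [add_right_comm]
  ring

theorem creation_comm {n : ℕ} (i j : Fin n) (ψ : (Fin n → ℕ) → ℂ) :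
    creation i (creation j ψ) = creation j (creation i ψ) := by
  rcases eq_or_ne i j with rfl | h
  · rfl
  funext k
  simp only [creation, Pi.sub_apply, Pi.single_eq_of_ne h, Pi.single_eq_of_ne h.symm, tsub_zero]
  rw [tsub_right_comm]
  ring

theorem sub_single_add_single {n : ℕ} {k : Fin n → ℕ} {j : Fin n} (h : 0 < k j) :
    k - Pi.single j 1 + Pi.single j 1 = k := by
  refine tsub_add_cancel_of_le fun i => ?_
  rcases eq_or_ne i j with rfl | hj
  · simpa using Nat.succ_le_of_lt h
  · simp [Pi.single_eq_of_ne hj]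

theorem annihilation_creation {n : ℕ} (i j : Fin n) (ψ : (Fin n → ℕ) → ℂ) :
    annihilation i (creation j ψ) - creation j (annihilation i ψ) =
      (if i = j then (1 : ℂ) else 0) • ψ := by
  funext k
  rcases eq_or_ne i j with rfl | h
  · simp only [annihilation, creation, Pi.add_apply, Pi.sub_apply, Pi.single_eq_same, if_true,
      one_smul, add_tsub_cancel_right, ← mul_assoc]
    -- At occupation number zero the subtraction is truncated, but the weight `√0` removes that
    -- term.
    rcases Nat.eq_zero_or_pos (k i) with h0 | h0
    · simp [h0]
    · have h1 : k - Pi.single i 1 + Pi.single i 1 = k := sub_single_add_single h0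
      have h2 : ((k i - 1 : ℕ) : ℝ) + 1 = k i := by
        rw [Nat.cast_sub h0]
        simp
      rw [h1, h2]
      push_cast
      rw [← Complex.ofReal_mul, ← Complex.ofReal_mul, Real.mul_self_sqrt (by positivity),
        Real.mul_self_sqrt (by positivity)]
      push_cast
      ring
  · have h1 : k - Pi.single j 1 + Pi.single i 1 = k + Pi.single i 1 - Pi.single j 1 := by
      funext l
      rcases eq_or_ne l i with rfl | hl
      · simp [Pi.single_eq_of_ne h]
      · simp [Pi.single_eq_of_ne hl]
    simp only [annihilation, creation, Pi.add_apply, Pi.sub_apply, Pi.single_eq_of_ne h,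
      Pi.single_eq_of_ne h.symm, if_neg h, add_zero, tsub_zero, h1]
    simp
    ring

/-- The canonical commutation relations. -/
theorem ladderRep_commutator {n : ℕ} (x y : Ladder n) :
    ladderRep (FreeAlgebra.ι ℂ x * FreeAlgebra.ι ℂ y - FreeAlgebra.ι ℂ y * FreeAlgebra.ι ℂ x) =
      (-Matrix.J (Fin n) ℂ x y) • 1 := by
  refine LinearMap.ext fun ψ => ?_
  rw [map_sub, map_mul, map_mul, ladderRep_ι, ladderRep_ι]
  change ladder x (ladder y ψ) - ladder y (ladder x ψ) = (-Matrix.J (Fin n) ℂ x y) • ψ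
  rcases x with i | i <;> rcases y with j | j
  · simp [ladder, Matrix.J, annihilation_comm i j]
  · simpa [ladder, Matrix.J, Matrix.one_apply] using annihilation_creation i j ψ
  · rw [← neg_sub]
    simp only [ladder, Sum.elim_inl, Sum.elim_inr, annihilation_creation, Matrix.J,
      Matrix.fromBlocks_apply₂₁, Matrix.one_apply, neg_smul, eq_comm (a := i)]
  · simp [ladder, Matrix.J, creation_comm i j]

/-- This makes ladder operators continuous for coordinatewise convergence, so they can be applied
termwise to series although they are unbounded. -/
theorem ladder_apply_eq_sum {n : ℕ} (i : Ladder n) (k : Fin n → ℕ) :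
    ∃ (l : Fin n → ℕ) (c : ℂ), ∀ ψ : (Fin n → ℕ) → ℂ, ladder i ψ k = c * ψ l := by
  rcases i with j | j
  · exact ⟨_, _, fun ψ => rfl⟩
  · exact ⟨_, _, fun ψ => rfl⟩

theorem inner_numberState {n : ℕ} (k : Fin n → ℕ) (ψ : FockSpace n) :
    inner ℂ (numberState k) ψ = ψ k := by
  rw [numberState, lp.inner_single_left]
  simp

theorem numberState_apply {n : ℕ} (k l : Fin n → ℕ) :
    numberState k l = if l = k then 1 else 0 := by
  rw [numberState, lp.single_apply, Pi.single_apply]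

/-- The image of a number state under the field operator `zᵀ𝔞`. -/
def fieldNumberState {n : ℕ} (z : Fin n → ℂ) (k : Fin n → ℕ) : FockSpace n :=
  ∑ j, ((z j * (Real.sqrt (k j : ℝ) : ℂ)) • numberState (k - Pi.single j 1) +
    (starRingEnd ℂ (z j) * (Real.sqrt ((k j : ℝ) + 1) : ℂ)) • numberState (k + Pi.single j 1))

theorem linearForm_numberState {n : ℕ} (z : Fin n → ℂ) (k : Fin n → ℕ) :
    (fieldNumberState z k : (Fin n → ℕ) → ℂ) = linearForm (phaseVec z) (numberState k) := by
  funext l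
  rw [linearForm, Fintype.sum_sum_type, ← Finset.sum_add_distrib, fieldNumberState, lp.coeFn_sum,
    Finset.sum_apply]
  refine Finset.sum_congr rfl fun j _ => ?_
  simp only [lp.coeFn_add, lp.coeFn_smul, Pi.add_apply, Pi.smul_apply, numberState_apply,
    smul_eq_mul, phaseVec, Sum.elim_inl, Sum.elim_inr, ladder, annihilation, creation, mul_ite,
    mul_one, mul_zero]
  congr 1
  · by_cases h : l + Pi.single j 1 = k
    · subst h
      simp
    · rw [if_neg h]
      split_ifs with h'
      · rcases Nat.eq_zero_or_pos (k j) with h0 | h0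
        · simp [h0]
        · refine absurd ?_ h
          rw [h', sub_single_add_single h0]
      · rfl
  · by_cases h : l = k + Pi.single j 1
    · subst h
      simp
    · rw [if_neg h]
      split_ifs with h'
      · rcases Nat.eq_zero_or_pos (l j) with h0 | h0
        · simp [h0]
        · refine absurd ?_ h
          rw [← h', sub_single_add_single h0]
      · rfl

/-- The formal adjoint relation against number states holds for every `ψ`, in the domain or not. -/
theorem inner_fieldNumberState {n : ℕ} (z : Fin n → ℂ) (k : Fin n → ℕ) (ψ : FockSpace n) :
    inner ℂ (fieldNumberState z k) ψ = linearForm (phaseVec z) ψ k := by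
  rw [linearForm, Fintype.sum_sum_type, ← Finset.sum_add_distrib, fieldNumberState, sum_inner]
  refine Finset.sum_congr rfl fun j _ => ?_
  simp only [inner_add_left, inner_smul_left, inner_numberState, phaseVec, Sum.elim_inl,
    Sum.elim_inr, ladder, annihilation, creation, map_mul, Complex.conj_conj, Complex.conj_ofReal]
  ring

/-! ### Decomposition of the state and traces -/

theorem ContinuousLinearMap.IsPositive.exists_sqrt {H : Type*} [NormedAddCommGroup H]
    [InnerProductSpace ℂ H] [CompleteSpace H] {T : H →L[ℂ] H} (hT : T.IsPositive) :
    ∃ S : H →L[ℂ] H, IsSelfAdjoint S ∧ S * S = T := by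
  have h0 : 0 ≤ T := (ContinuousLinearMap.nonneg_iff_isPositive T).2 hT
  exact ⟨CFC.sqrt T, (CFC.sqrt_nonneg T).isSelfAdjoint, CFC.sqrt_mul_sqrt_self T h0⟩

/-- A positive operator whose matrix has a finite trace is `∑ₗ |vₗ⟩⟨vₗ|` for a square summable
family of vectors. -/
theorem exists_decomposition {n : ℕ} {ρ : FockSpace n →L[ℂ] FockSpace n} (hρ : ρ.IsPositive)
    (htr : opTrace ρ = 1) :
    ∃ v : (Fin n → ℕ) → FockSpace n, Summable (fun l => ‖v l‖ ^ 2) ∧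
      ∀ ψ, HasSum (fun l => inner ℂ (v l) ψ • v l) (ρ ψ) := by
  obtain ⟨S, hsa, hSS⟩ := hρ.exists_sqrt
  have hsym : ∀ x y : FockSpace n, inner ℂ (S x) y = inner ℂ x (S y) := fun x y => by
    rw [← ContinuousLinearMap.adjoint_inner_left,
      ContinuousLinearMap.isSelfAdjoint_iff'.1 hsa]
  have hnorm : ∀ l, inner ℂ (numberState l) (ρ (numberState l)) =
      ((‖S (numberState l)‖ ^ 2 : ℝ) : ℂ) := by
    intro l
    rw [← hSS, mul_apply_eq_comp, ← hsym, inner_self_eq_norm_sq_to_K]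
    push_cast
    rfl
  refine ⟨fun l => S (numberState l), ?_, fun ψ => ?_⟩
  · have : Summable fun l : Fin n → ℕ => inner ℂ (numberState l) (ρ (numberState l)) := by
      -- A divergent series would have the default sum `0`, contradicting trace one.
      by_contra h
      rw [opTrace, tsum_eq_zero_of_not_summable h] at htr
      exact zero_ne_one htr
    simp only [hnorm] at this
    exact_mod_cast this
  · have h1 : HasSum (fun l => lp.single 2 l (S ψ l)) (S ψ) := lp.hasSum_single (by simp) _
    have h2 := S.hasSum h1
    rw [← mul_apply_eq_comp, hSS] at h2
    convert h2 using 2 with l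
    rw [hsym, inner_numberState, ← map_smul, numberState, ← lp.single_smul, smul_eq_mul, mul_one]

theorem summable_mul_norm_of_sq {ι E : Type*} [NormedAddCommGroup E] [InnerProductSpace ℂ E]
    {x y : ι → E} (hx : Summable fun l => ‖x l‖ ^ 2) (hy : Summable fun l => ‖y l‖ ^ 2) :
    Summable fun l => ‖x l‖ * ‖y l‖ := by
  refine Summable.of_nonneg_of_le (fun l => by positivity) (fun l => ?_) (hx.add hy)
  nlinarith [sq_nonneg (‖x l‖ - ‖y l‖), sq_nonneg (‖x l‖), sq_nonneg (‖y l‖)]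

theorem hasSum_norm_sq {n : ℕ} (ψ : FockSpace n) :
    HasSum (fun k => ‖ψ k‖ ^ 2) (‖ψ‖ ^ 2) := by
  have := lp.hasSum_norm (p := 2) (by norm_num) ψ
  simpa using this

/-- Square summability over two indices. -/
theorem summable_prod_iff {n : ℕ} {ι : Type*} (x : ι → FockSpace n) :
    Summable (fun l => ‖x l‖ ^ 2) ↔ Summable fun p : ι × (Fin n → ℕ) => ‖x p.1 p.2‖ ^ 2 := by
  rw [summable_prod_of_nonneg (fun _ => by positivity)]
  simp only [(hasSum_norm_sq _).tsum_eq]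
  exact ⟨fun h => ⟨fun l => (hasSum_norm_sq (x l)).summable, h⟩, fun h => h.2⟩

theorem summable_mul_prod {n : ℕ} {ι : Type*} {x y : ι → FockSpace n}
    (hx : Summable fun l => ‖x l‖ ^ 2) (hy : Summable fun l => ‖y l‖ ^ 2) :
    Summable fun p : ι × (Fin n → ℕ) => starRingEnd ℂ (y p.1 p.2) * x p.1 p.2 := by
  rw [summable_prod_iff] at hx hy
  refine Summable.of_norm ?_
  refine Summable.of_nonneg_of_le (fun l => by positivity) (fun l => ?_) (hx.add hy)
  rw [norm_mul, RCLike.norm_conj]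
  nlinarith [sq_nonneg (‖x l.1 l.2‖ - ‖y l.1 l.2‖), sq_nonneg (‖x l.1 l.2‖),
    sq_nonneg (‖y l.1 l.2‖)]

/-- The trace of `∑ₗ |xₗ⟩⟨yₗ|`. -/
theorem tsum_tsum_eq_tsum_inner {n : ℕ} {ι : Type*} {x y : ι → FockSpace n}
    (hx : Summable fun l => ‖x l‖ ^ 2) (hy : Summable fun l => ‖y l‖ ^ 2) :
    ∑' k, ∑' l, starRingEnd ℂ (y l k) * x l k = ∑' l, inner ℂ (y l) (x l) := by
  have h := summable_mul_prod hx hy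
  rw [Summable.tsum_comm (f := fun l k => starRingEnd ℂ (y l k) * x l k) h]
  refine tsum_congr fun l => ?_
  rw [lp.inner_eq_tsum]
  exact tsum_congr fun k => by rw [RCLike.inner_apply, mul_comm]

theorem inner_numberState_right {n : ℕ} (k : Fin n → ℕ) (ψ : FockSpace n) :
    inner ℂ ψ (numberState k) = starRingEnd ℂ (ψ k) := by
  rw [← inner_conj_symm, inner_numberState]

theorem hasSum_coord {n : ℕ} {ι : Type*} {x : ι → FockSpace n} {s : FockSpace n}
    (h : HasSum x s) (k : Fin n → ℕ) : HasSum (fun l => x l k) (s k) := by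
  have := (innerSL ℂ (numberState k)).hasSum h
  simpa [inner_numberState] using this

theorem opTrace_mul_eq {n : ℕ} {ρ W : FockSpace n →L[ℂ] FockSpace n}
    {v : (Fin n → ℕ) → FockSpace n} (hv : Summable fun l => ‖v l‖ ^ 2)
    (hρ : ∀ ψ, HasSum (fun l => inner ℂ (v l) ψ • v l) (ρ ψ)) :
    opTrace (W * ρ) = ∑' l, inner ℂ (v l) (W (v l)) := by
  have hW : Summable fun l => ‖W (v l)‖ ^ 2 := by
    refine Summable.of_nonneg_of_le (fun l => by positivity) (fun l => ?_) (hv.mul_left (‖W‖ ^ 2))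
    rw [← mul_pow]
    gcongr
    exact W.le_opNorm _
  rw [← tsum_tsum_eq_tsum_inner hW hv, opTrace]
  refine tsum_congr fun k => ?_
  rw [inner_numberState]
  have := hasSum_coord (W.hasSum (hρ (numberState k))) k
  rw [mul_apply_eq_comp, ← this.tsum_eq]
  refine tsum_congr fun l => ?_
  rw [map_smul, inner_numberState_right]
  rfl

/-! ### Unitary groups of field operators -/

theorem phaseVec_ofReal_smul {n : ℕ} (t : ℝ) (z : Fin n → ℂ) :
    phaseVec ((t : ℂ) • z) = (t : ℂ) • phaseVec z := by
  funext i
  rcases i with j | j <;> simp [phaseVec]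

namespace IsFieldGroup

variable {n : ℕ} {z : Fin n → ℂ} {U : ℝ → FockSpace n →L[ℂ] FockSpace n}

theorem inner_map_map (hU : IsFieldGroup z U) (t : ℝ) (x y : FockSpace n) :
    inner ℂ (U t x) (U t y) = inner ℂ x y := by
  rw [← ContinuousLinearMap.adjoint_inner_left, ← mul_apply_eq_comp,
    ← ContinuousLinearMap.star_eq_adjoint, (Unitary.mem_iff.1 (hU.mem_unitary t)).1]
  rfl

theorem norm_map (hU : IsFieldGroup z U) (t : ℝ) (x : FockSpace n) : ‖U t x‖ = ‖x‖ := by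
  rw [← sq_eq_sq₀ (norm_nonneg _) (norm_nonneg _), ← inner_self_eq_norm_sq (𝕜 := ℂ),
    hU.inner_map_map, inner_self_eq_norm_sq]

theorem map_add_apply (hU : IsFieldGroup z U) (s t : ℝ) (x : FockSpace n) :
    U (s + t) x = U s (U t x) := by
  rw [hU.map_add]
  rfl

theorem map_zero_apply (hU : IsFieldGroup z U) (x : FockSpace n) : U 0 x = x := by
  rw [hU.map_zero]
  rfl

theorem inner_map_left (hU : IsFieldGroup z U) (t : ℝ) (x y : FockSpace n) :
    inner ℂ (U t x) y = inner ℂ x (U (-t) y) := by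
  rw [← hU.inner_map_map (-t), ← hU.map_add_apply, neg_add_cancel, hU.map_zero_apply]

theorem hasDerivAt (hU : IsFieldGroup z U) {x y : FockSpace n}
    (h : (y : (Fin n → ℕ) → ℂ) = linearForm (phaseVec z) x) (t : ℝ) :
    HasDerivAt (fun s => U s x) (Complex.I • U t y) t := by
  have h0 := (hU.generator x y).2 h
  have h1 : HasDerivAt (fun s => U (s - t) x) (Complex.I • y) t :=
    HasDerivAt.comp_sub_const t t (by rwa [sub_self])
  have h2 := ((U t).restrictScalars ℝ).hasFDerivAt.comp_hasDerivAt t h1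
  rw [ContinuousLinearMap.coe_restrictScalars', map_smul] at h2
  have e : (fun s => U s x) = U t ∘ fun s => U (s - t) x := by
    funext s
    simp [← hU.map_add_apply]
  rw [e]
  exact h2

/-- `U t` commutes with the group, hence preserves the domain of its generator and commutes with the
generator there. -/
theorem map_domain (hU : IsFieldGroup z U) {x y : FockSpace n}
    (h : (y : (Fin n → ℕ) → ℂ) = linearForm (phaseVec z) x) (t : ℝ) :
    (U t y : (Fin n → ℕ) → ℂ) = linearForm (phaseVec z) (U t x) := by
  rw [← hU.generator]
  have h0 := (hU.generator x y).2 h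
  have h2 := ((U t).restrictScalars ℝ).hasFDerivAt.comp_hasDerivAt 0 h0
  rw [ContinuousLinearMap.coe_restrictScalars', map_smul] at h2
  have e : (fun s => U s (U t x)) = U t ∘ fun s => U s x := by
    funext s
    simp [← hU.map_add_apply, add_comm]
  rw [e]
  exact h2

theorem symmetric (hU : IsFieldGroup z U) {x x' y y' : FockSpace n}
    (hx : (x' : (Fin n → ℕ) → ℂ) = linearForm (phaseVec z) x)
    (hy : (y' : (Fin n → ℕ) → ℂ) = linearForm (phaseVec z) y) :
    inner ℂ x' y = inner ℂ x y' := by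
  have h := (hU.hasDerivAt hx 0).inner ℂ (hU.hasDerivAt hy 0)
  simp only [hU.inner_map_map, hU.map_zero_apply, inner_smul_left, inner_smul_right,
    Complex.conj_I] at h
  have := h.unique (hasDerivAt_const (0 : ℝ) (inner ℂ x y))
  have h' : Complex.I * (inner ℂ x y' - inner ℂ x' y) = 0 := by linear_combination this
  rcases mul_eq_zero.1 h' with h' | h'
  · exact absurd h' Complex.I_ne_zero
  · exact (sub_eq_zero.1 h').symm

/-- Both groups have the same symmetric generator and keep its domain invariant, so `⟨V t eₖ, U t
eₗ⟩` has zero derivative. Hence `V (-t) (U t eₗ)` has the coordinates of `eₗ`. -/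
theorem ext {V : ℝ → FockSpace n →L[ℂ] FockSpace n} (hU : IsFieldGroup z U)
    (hV : IsFieldGroup z V) : U = V := by
  have key : ∀ (k l : Fin n → ℕ) (t : ℝ),
      inner ℂ (V t (numberState k)) (U t (numberState l)) =
        inner ℂ (numberState k) (numberState l) := by
    intro k l t
    have hd : ∀ s : ℝ, HasDerivAt
        (fun s => inner ℂ (V s (numberState k)) (U s (numberState l))) 0 s := by
      intro s
      have h := (hV.hasDerivAt (linearForm_numberState z k) s).inner ℂ
        (hU.hasDerivAt (linearForm_numberState z l) s)
      have hs := hU.symmetric (hV.map_domain (linearForm_numberState z k) s)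
        (hU.map_domain (linearForm_numberState z l) s)
      refine h.congr_deriv ?_
      rw [inner_smul_left, inner_smul_right, hs, Complex.conj_I]
      ring
    have := is_const_of_deriv_eq_zero (fun s => (hd s).differentiableAt) (fun s => (hd s).deriv) t 0
    simpa [hU.map_zero_apply, hV.map_zero_apply] using this
  funext t
  have hns : ∀ l, U t (numberState l) = V t (numberState l) := by
    intro l
    have h1 : V (-t) (U t (numberState l)) = numberState l := by
      refine lp.ext ?_
      funext k
      rw [← inner_numberState, ← inner_numberState, ← key k l t, hV.inner_map_left]
    rw [← h1, ← hV.map_add_apply, add_neg_cancel, hV.map_zero_apply, h1]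
  refine ContinuousLinearMap.ext fun ψ => ?_
  have h1 : HasSum (fun l => lp.single 2 l (ψ l)) ψ := lp.hasSum_single (by simp) _
  refine ((U t).hasSum h1).unique ?_
  convert (V t).hasSum h1 using 2 with l
  have : lp.single 2 l (ψ l) = ψ l • numberState l := by
    rw [numberState, ← lp.single_smul, smul_eq_mul, mul_one]
  rw [this, map_smul, map_smul, hns]

theorem scale (hU : IsFieldGroup z U) {t : ℝ} (ht : t ≠ 0) :
    IsFieldGroup ((t : ℂ) • z) (fun s => U (s * t)) where
  map_zero := by simp [hU.map_zero]
  map_add r s := by simp [add_mul, hU.map_add]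
  mem_unitary s := hU.mem_unitary _
  continuous ψ := (hU.continuous ψ).comp (continuous_id.mul continuous_const)
  generator ψ φ := by
    have ht' : (t : ℂ) ≠ 0 := Complex.ofReal_ne_zero.2 ht
    have hl : linearForm (phaseVec ((t : ℂ) • z)) ψ = (t : ℂ) • linearForm (phaseVec z) ψ := by
      rw [← ladderRep_freeForm, ← ladderRep_freeForm, phaseVec_ofReal_smul, map_smul, map_smul,
        LinearMap.smul_apply]
    have h1 : (φ : (Fin n → ℕ) → ℂ) = linearForm (phaseVec ((t : ℂ) • z)) ψ ↔
        (((t : ℂ)⁻¹ • φ : FockSpace n) : (Fin n → ℕ) → ℂ) = linearForm (phaseVec z) ψ := by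
      rw [hl, lp.coeFn_smul, inv_smul_eq_iff₀ ht']
    rw [h1, ← hU.generator]
    constructor
    · intro h
      have h2 : HasDerivAt (fun s => U (s * t) ψ) (Complex.I • φ) (0 * t⁻¹) := by simpa using h
      have h3 := h2.scomp (h := fun s : ℝ => s * t⁻¹) 0 ((hasDerivAt_id (0 : ℝ)).mul_const t⁻¹)
      have e : (fun s => U s ψ) = (fun s => U (s * t) ψ) ∘ fun s => s * t⁻¹ := by
        funext s
        simp [ht]
      rw [e]
      refine h3.congr_deriv ?_
      rw [one_mul, smul_comm Complex.I, ← Complex.ofReal_inv]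
      rfl
    · intro h
      have h2 : HasDerivAt (fun s => U s ψ) (Complex.I • (t : ℂ)⁻¹ • φ) (0 * t) := by simpa using h
      have h3 := h2.scomp (h := fun s : ℝ => s * t) 0 ((hasDerivAt_id (0 : ℝ)).mul_const t)
      refine h3.congr_deriv ?_
      have e : ((1 * t : ℝ) : ℂ) • Complex.I • (t : ℂ)⁻¹ • φ = Complex.I • φ := by
        rw [one_mul, smul_comm, smul_inv_smul₀ ht']
      exact e

end IsFieldGroup

/-! ### Correlation functions, domains and Gaussian moments -/

namespace IsFieldGroup

variable {n : ℕ} {z : Fin n → ℂ} {U : ℝ → FockSpace n →L[ℂ] FockSpace n} {ι : Type*}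

theorem norm_inner_le (hU : IsFieldGroup z U) (x y : FockSpace n) (t : ℝ) :
    ‖inner ℂ x (U t y)‖ ≤ ‖x‖ * ‖y‖ := by
  rw [← hU.norm_map t y]
  exact norm_inner_le_norm _ _

theorem summable_inner (hU : IsFieldGroup z U) {x y : ι → FockSpace n}
    (hx : Summable fun l => ‖x l‖ ^ 2) (hy : Summable fun l => ‖y l‖ ^ 2) (t : ℝ) :
    Summable fun l => inner ℂ (x l) (U t (y l)) :=
  Summable.of_norm_bounded (summable_mul_norm_of_sq hx hy) fun _ => hU.norm_inner_le _ _ _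

theorem hasDerivAt_tsum_right (hU : IsFieldGroup z U) {x y y' : ι → FockSpace n}
    (hy' : ∀ l, (y' l : (Fin n → ℕ) → ℂ) = linearForm (phaseVec z) (y l))
    (hx : Summable fun l => ‖x l‖ ^ 2) (hy : Summable fun l => ‖y l‖ ^ 2)
    (hys : Summable fun l => ‖y' l‖ ^ 2) (t : ℝ) :
    HasDerivAt (fun t => ∑' l, inner ℂ (x l) (U t (y l)))
      (Complex.I * ∑' l, inner ℂ (x l) (U t (y' l))) t := by
  rw [← tsum_mul_left]
  refine hasDerivAt_tsum (g := fun l t => inner ℂ (x l) (U t (y l)))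
    (g' := fun l t => Complex.I * inner ℂ (x l) (U t (y' l)))
    (summable_mul_norm_of_sq hx hys) (fun l s => ?_) (fun l s => ?_)
    (hU.summable_inner hx hy 0) t
  · refine ((hasDerivAt_const s (x l)).inner ℂ (hU.hasDerivAt (hy' l) s)).congr_deriv ?_
    rw [inner_smul_right, inner_zero_left, add_zero]
  · rw [norm_mul, Complex.norm_I, one_mul]
    exact hU.norm_inner_le _ _ _

/-- Moving the group to the left argument lets a second derivative be taken while each argument
enters the generator only once. -/
theorem hasDerivAt_tsum_left (hU : IsFieldGroup z U) {x x' y : ι → FockSpace n}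
    (hx' : ∀ l, (x' l : (Fin n → ℕ) → ℂ) = linearForm (phaseVec z) (x l))
    (hx : Summable fun l => ‖x l‖ ^ 2) (hxs : Summable fun l => ‖x' l‖ ^ 2)
    (hy : Summable fun l => ‖y l‖ ^ 2) (t : ℝ) :
    HasDerivAt (fun t => ∑' l, inner ℂ (x l) (U t (y l)))
      (Complex.I * ∑' l, inner ℂ (x' l) (U t (y l))) t := by
  have hflip : ∀ (a b : FockSpace n) (s : ℝ), inner ℂ a (U s b) = inner ℂ (U (-s) a) b := by
    intro a b s
    rw [hU.inner_map_left, neg_neg]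
  rw [← tsum_mul_left]
  refine hasDerivAt_tsum (g := fun l t => inner ℂ (x l) (U t (y l)))
    (g' := fun l t => Complex.I * inner ℂ (x' l) (U t (y l)))
    (summable_mul_norm_of_sq hxs hy) (fun l s => ?_) (fun l s => ?_)
    (hU.summable_inner hx hy 0) t
  · have h1 : HasDerivAt (fun s => U (-s) (x l)) (-(Complex.I • U (-s) (x' l))) s := by
      have := (hU.hasDerivAt (hx' l) (-s)).scomp s (hasDerivAt_neg s)
      rwa [neg_one_smul] at this
    simp only [hflip]
    refine (h1.inner ℂ (hasDerivAt_const s (y l))).congr_deriv ?_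
    rw [inner_zero_right, zero_add, inner_neg_left, inner_smul_left, Complex.conj_I]
    ring
  · rw [norm_mul, Complex.norm_I, one_mul]
    exact hU.norm_inner_le _ _ _

/-- A quadratic bound at the origin for the correlation function of a family implies that the
family lies in the domain of the generator, with square summable images. -/
theorem exists_image_of_bound (hU : IsFieldGroup z U) {x : ι → FockSpace n}
    (hx : Summable fun l => ‖x l‖ ^ 2) {M : ℝ}
    (hM : ∀ᶠ t in nhdsWithin (0 : ℝ) (Set.Ioi 0),
      (∑' l, inner ℂ (x l) (U 0 (x l)) - ∑' l, inner ℂ (x l) (U t (x l))).re ≤ M * t ^ 2) :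
    ∃ y : ι → FockSpace n,
      (∀ l, (y l : (Fin n → ℕ) → ℂ) = linearForm (phaseVec z) (x l)) ∧
      Summable fun l => ‖y l‖ ^ 2 := by
  set q : ℝ → ι × (Fin n → ℕ) → ℝ := fun t p => ‖t⁻¹ • (U t (x p.1) p.2 - x p.1 p.2)‖ ^ 2
  -- Coordinates of the difference quotients converge before `x l` is known to lie in the domain,
  -- because the group can be moved onto a number state, which does.
  have hlim : ∀ p : ι × (Fin n → ℕ), Filter.Tendsto (fun t => q t p)
      (nhdsWithin (0 : ℝ) (Set.Ioi 0)) (nhds (‖linearForm (phaseVec z) (x p.1) p.2‖ ^ 2)) := by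
    rintro ⟨l, k⟩
    have h1 : HasDerivAt (fun s => inner ℂ (numberState k) (U s (x l)))
        (Complex.I * linearForm (phaseVec z) (x l) k) 0 := by
      have h2 : HasDerivAt (fun s => U (-s) (numberState k))
          (-(Complex.I • U (-0) (fieldNumberState z k))) 0 := by
        have := (hU.hasDerivAt (linearForm_numberState z k) (-0)).scomp (0 : ℝ) (hasDerivAt_neg 0)
        rwa [neg_one_smul] at this
      have h3 := h2.inner ℂ (hasDerivAt_const (0 : ℝ) (x l))
      simp only [hU.inner_map_left, neg_neg] at h3
      refine h3.congr_deriv ?_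
      rw [_root_.map_zero, inner_zero_right, zero_add, inner_neg_left, inner_smul_left, neg_zero,
        hU.map_zero_apply, inner_fieldNumberState,
        Complex.conj_I]
      ring
    have h2 := (hasDerivAt_iff_tendsto_slope.1 h1).mono_left
      (nhdsWithin_mono 0 (fun t (ht : t ∈ Set.Ioi (0 : ℝ)) => ne_of_gt ht))
    have h3 := (h2.norm).pow 2
    rw [norm_mul, Complex.norm_I, one_mul] at h3
    refine h3.congr fun t => ?_
    simp only [slope, vsub_eq_sub, sub_zero, inner_numberState, hU.map_zero_apply, q]
  have hbound : ∀ t, 0 < t →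
      (∑' l, inner ℂ (x l) (U 0 (x l)) - ∑' l, inner ℂ (x l) (U t (x l))).re ≤ M * t ^ 2 →
      ∀ s : Finset (ι × (Fin n → ℕ)), ∑ p ∈ s, q t p ≤ 2 * M := by
    intro t ht h s
    have e : ∀ l, ‖U t (x l) - x l‖ ^ 2 =
        2 * (inner ℂ (x l) (U 0 (x l)) - inner ℂ (x l) (U t (x l))).re := by
      intro l
      have := norm_sub_sq (𝕜 := ℂ) (U t (x l)) (x l)
      have h1 : (inner ℂ (x l) (x l) : ℂ).re = ‖x l‖ ^ 2 := inner_self_eq_norm_sq (𝕜 := ℂ) (x l)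
      rw [this, hU.norm_map, hU.map_zero_apply, Complex.sub_re, h1, inner_re_symm]
      simp only [RCLike.re_to_complex]
      ring
    have hs0 := hU.summable_inner hx hx 0
    have hst := hU.summable_inner hx hx t
    have h1 : HasSum (fun l => ‖U t (x l) - x l‖ ^ 2)
        (2 * (∑' l, inner ℂ (x l) (U 0 (x l)) - ∑' l, inner ℂ (x l) (U t (x l))).re) := by
      simp only [e]
      exact (Complex.hasSum_re (hs0.hasSum.sub hst.hasSum)).mul_left 2
    have h2 := (summable_prod_iff fun l => U t (x l) - x l).1 h1.summable
    have h3 : ∑' p : ι × (Fin n → ℕ), ‖(U t (x p.1) - x p.1) p.2‖ ^ 2 ≤ 2 * (M * t ^ 2) := by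
      rw [h2.tsum_prod]
      simp only [(hasSum_norm_sq _).tsum_eq]
      rw [h1.tsum_eq]
      linarith
    have h4 : ∑ p ∈ s, q t p = (t⁻¹) ^ 2 * ∑ p ∈ s, ‖(U t (x p.1) - x p.1) p.2‖ ^ 2 := by
      rw [Finset.mul_sum]
      refine Finset.sum_congr rfl fun p _ => ?_
      simp only [q, norm_smul, mul_pow, Real.norm_eq_abs, sq_abs, lp.coeFn_sub, Pi.sub_apply]
    rw [h4]
    calc (t⁻¹) ^ 2 * ∑ p ∈ s, ‖(U t (x p.1) - x p.1) p.2‖ ^ 2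
        ≤ (t⁻¹) ^ 2 * (2 * (M * t ^ 2)) := by
          gcongr
          exact (h2.sum_le_tsum s fun _ _ => by positivity).trans h3
      _ = 2 * M := by field_simp
  -- Fatou by hand: finite sums are bounded by `2 * M` uniformly for small `t`, and the bound passes
  -- to the limit.
  have hsum : Summable fun p : ι × (Fin n → ℕ) => ‖linearForm (phaseVec z) (x p.1) p.2‖ ^ 2 := by
    refine summable_of_sum_le (c := 2 * M) (fun p => by positivity) fun s => ?_
    refine le_of_tendsto (tendsto_finsetSum s fun p _ => hlim p) ?_
    filter_upwards [hM, self_mem_nhdsWithin] with t h ht using hbound t ht h s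
  -- The generator has its maximal domain, so a square summable formal image is enough.
  have hmem : ∀ l, Memℓp (linearForm (phaseVec z) (x l)) 2 := by
    intro l
    rw [memℓp_gen_iff (by norm_num)]
    simpa using ((summable_prod_of_nonneg fun _ => by positivity).1 hsum).1 l
  refine ⟨fun l => ⟨_, hmem l⟩, fun l => rfl, ?_⟩
  rw [summable_prod_iff]
  exact hsum

end IsFieldGroup

/-- The maximum at `0` removes the linear term of the Taylor expansion. -/
theorem exists_quadratic_bound {h : ℝ → ℂ} (hh : ContDiff ℝ 2 h) (hmax : ∀ t, (h t).re ≤ (h 0).re) :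
    ∃ M, ∀ᶠ t in nhdsWithin (0 : ℝ) (Set.Ioi 0), (h 0 - h t).re ≤ M * t ^ 2 := by
  set r : ℝ → ℝ := fun t => (h t).re
  have hr : ContDiff ℝ 2 r := Complex.reCLM.contDiff.comp hh
  have hd : deriv r 0 = 0 := IsLocalMax.deriv_eq_zero (Filter.Eventually.of_forall hmax)
  obtain ⟨M, hM⟩ := exists_taylor_mean_remainder_bound (n := 1) (zero_le_one (α := ℝ))
    (hr.contDiffOn (s := Set.Icc 0 1))
  refine ⟨M, ?_⟩
  filter_upwards [Ioo_mem_nhdsGT (zero_lt_one (α := ℝ))] with t ht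
  have h1 := hM t ⟨ht.1.le, ht.2.le⟩
  have hw : derivWithin r (Set.Icc 0 1) 0 = 0 := by
    rw [(hr.differentiable (by norm_num) 0).derivWithin
      (uniqueDiffOn_Icc zero_lt_one 0 ⟨le_rfl, zero_le_one⟩), hd]
  rw [taylorWithinEval_succ, taylor_within_zero_eval, iteratedDerivWithin_one, hw, smul_zero,
    add_zero, Real.norm_eq_abs, sub_zero] at h1
  have := neg_abs_le (r t - r 0)
  rw [Complex.sub_re]
  change r 0 - r t ≤ _
  norm_num at h1
  linarith

namespace IsFieldGroup

variable {n : ℕ} {z : Fin n → ℂ} {U : ℝ → FockSpace n →L[ℂ] FockSpace n} {ι : Type*}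

/-- The new correlation function is minus the second derivative of the old one. Asking for infinite
smoothness makes the hypothesis reproduce itself, so the step can be iterated. -/
theorem exists_image_of_contDiff (hU : IsFieldGroup z U) {x : ι → FockSpace n}
    (hx : Summable fun l => ‖x l‖ ^ 2)
    (hh : ContDiff ℝ (⊤ : ℕ∞) fun t => ∑' l, inner ℂ (x l) (U t (x l))) :
    ∃ y : ι → FockSpace n,
      (∀ l, (y l : (Fin n → ℕ) → ℂ) = linearForm (phaseVec z) (x l)) ∧
      (Summable fun l => ‖y l‖ ^ 2) ∧
      ContDiff ℝ (⊤ : ℕ∞) fun t => ∑' l, inner ℂ (y l) (U t (y l)) := by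
  have hmax : ∀ t, (∑' l, inner ℂ (x l) (U t (x l))).re ≤
      (∑' l, inner ℂ (x l) (U 0 (x l))).re := by
    intro t
    rw [Complex.re_tsum (hU.summable_inner hx hx t), Complex.re_tsum (hU.summable_inner hx hx 0)]
    refine Summable.tsum_le_tsum (fun l => ?_) (Complex.reCLM.summable (hU.summable_inner hx hx t))
      (Complex.reCLM.summable (hU.summable_inner hx hx 0))
    have h1 : (inner ℂ (x l) (x l) : ℂ).re = ‖x l‖ * ‖x l‖ := by
      rw [← sq]
      exact inner_self_eq_norm_sq (𝕜 := ℂ) (x l)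
    rw [hU.map_zero_apply, h1]
    exact (Complex.re_le_norm _).trans (hU.norm_inner_le _ _ _)
  obtain ⟨M, hM⟩ := exists_quadratic_bound (contDiff_infty.1 hh 2) hmax
  obtain ⟨y, hy, hys⟩ := hU.exists_image_of_bound hx hM
  refine ⟨y, hy, hys, ?_⟩
  have h1 : deriv (fun t => ∑' l, inner ℂ (x l) (U t (x l))) =
      fun t => Complex.I * ∑' l, inner ℂ (x l) (U t (y l)) :=
    funext fun t => (hU.hasDerivAt_tsum_right hy hx hx hys t).deriv
  have h2 : deriv (fun t => Complex.I * ∑' l, inner ℂ (x l) (U t (y l))) =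
      fun t => -∑' l, inner ℂ (y l) (U t (y l)) := by
    funext t
    rw [((hU.hasDerivAt_tsum_left hy hx hys hys t).const_mul Complex.I).deriv, ← mul_assoc,
      Complex.I_mul_I, neg_one_mul]
  have h3 := (contDiff_infty_iff_deriv.1 (contDiff_infty_iff_deriv.1 hh).2).2.neg
  rw [h1, h2] at h3
  simpa using h3

theorem exists_iterates (hU : IsFieldGroup z U) {v : ι → FockSpace n}
    (hv : Summable fun l => ‖v l‖ ^ 2)
    (hh : ContDiff ℝ (⊤ : ℕ∞) fun t => ∑' l, inner ℂ (v l) (U t (v l))) :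
    ∃ y : ℕ → ι → FockSpace n, y 0 = v ∧
      (∀ m l, (y (m + 1) l : (Fin n → ℕ) → ℂ) = linearForm (phaseVec z) (y m l)) ∧
      ∀ m, Summable fun l => ‖y m l‖ ^ 2 := by
  let G := {x : ι → FockSpace n // (Summable fun l => ‖x l‖ ^ 2) ∧
    ContDiff ℝ (⊤ : ℕ∞) fun t => ∑' l, inner ℂ (x l) (U t (x l))}
  have step : ∀ x : G, ∃ y : G, ∀ l,
      (y.1 l : (Fin n → ℕ) → ℂ) = linearForm (phaseVec z) (x.1 l) := by
    rintro ⟨x, hx, hx'⟩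
    obtain ⟨y, hy, hy'⟩ := hU.exists_image_of_contDiff hx hx'
    exact ⟨⟨y, hy'⟩, hy⟩
  choose F hF using step
  refine ⟨fun m => (F^[m] ⟨v, hv, hh⟩).1, rfl, fun m l => ?_, fun m => (F^[m] ⟨v, hv, hh⟩).2.1⟩
  have := hF (F^[m] ⟨v, hv, hh⟩) l
  rwa [← Function.iterate_succ_apply' F] at this

/-- If the correlation function of a family is a centred Gaussian, the family lies in the domain
of all powers of the generator, and the moments satisfy the Gaussian recursion. -/
theorem gaussian_moments (hU : IsFieldGroup z U) {v : ι → FockSpace n}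
    (hv : Summable fun l => ‖v l‖ ^ 2) {q : ℂ}
    (hf : ∀ t : ℝ, ∑' l, inner ℂ (v l) (U t (v l)) = Complex.exp (-(q / 2) * (t : ℂ) ^ 2))
    {c : ℕ → ℂ} (h0 : c 0 = 1) (h1 : c 1 = 0) (hc : ∀ m, c (m + 2) = (m + 1) * q * c m) (m : ℕ) :
    ∃ y : ι → FockSpace n,
      (∀ l, (y l : (Fin n → ℕ) → ℂ) = ladderRep (freeForm (phaseVec z) ^ m) (v l)) ∧
      (Summable fun l => ‖y l‖ ^ 2) ∧ ∑' l, inner ℂ (v l) (y l) = c m := by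
  obtain ⟨y, hy0, hy, hys⟩ := hU.exists_iterates hv (by
    simp only [hf]
    have : ContDiff ℝ (⊤ : ℕ∞) fun t : ℝ => (t : ℂ) := Complex.ofRealCLM.contDiff
    exact (contDiff_const.mul (this.pow 2)).cexp)
  set g : ℕ → ℝ → ℂ := fun m t => ∑' l, inner ℂ (v l) (U t (y m l)) with hg
  have hd : ∀ m t, HasDerivAt (g m) (Complex.I * g (m + 1) t) t := fun m t =>
    hU.hasDerivAt_tsum_right (hy m) hv (hys m) (hys (m + 1)) t
  have hreal : ∀ t : ℝ, HasDerivAt (fun t : ℝ => (t : ℂ)) 1 t := fun t =>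
    Complex.ofRealCLM.hasDerivAt
  -- This is the differential equation `h' = -q t h` of the Gaussian; differentiating it repeatedly
  -- gives `hrec`.
  have hg1 : ∀ t : ℝ, g 1 t = Complex.I * q * t * g 0 t := by
    intro t
    have hg0 : g 0 = fun t : ℝ => Complex.exp (-(q / 2) * (t : ℂ) ^ 2) := by
      funext t
      rw [← hf t, hg, ← hy0]
    have e1 := (((hreal t).pow 2).const_mul (-(q / 2))).cexp
    have e2 := hd 0 t
    rw [hg0] at e2
    have e := e2.unique e1
    simp only [hg0]
    simp only [zero_add, Nat.cast_ofNat, Pi.pow_apply] at e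
    linear_combination (-Complex.I) * e + (g 1 t) * Complex.I_mul_I
  have hrec : ∀ m (t : ℝ), g (m + 2) t = (m + 1) * q * g m t + Complex.I * q * t * g (m + 1) t := by
    intro m
    induction m with
    | zero =>
      intro t
      have e1 := ((hreal t).const_mul (Complex.I * q)).mul (hd 0 t)
      have e2 := hd 1 t
      rw [funext hg1] at e2
      have e := e2.unique e1
      simp only [zero_add, Nat.cast_zero] at e ⊢
      linear_combination (-Complex.I) * e +
        (g 2 t - q * g 0 t - Complex.I * q * t * g 1 t) * Complex.I_mul_I
    | succ m ih =>
      intro t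
      have e1 := ((hd m t).const_mul ((m + 1) * q)).add
        (((hreal t).const_mul (Complex.I * q)).mul (hd (m + 1) t))
      have e2 := hd (m + 2) t
      rw [funext ih] at e2
      have e := e2.unique e1
      push_cast
      linear_combination (-Complex.I) * e +
        (g (m + 3) t - (m + 2) * q * g (m + 1) t - Complex.I * q * t * g (m + 2) t) *
          Complex.I_mul_I
  have hgc : ∀ m, g m 0 = c m ∧ g (m + 1) 0 = c (m + 1) := by
    intro m
    induction m with
    | zero =>
      refine ⟨?_, ?_⟩
      · rw [h0, hg]
        simp only [hy0, hf]
        simp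
      · rw [zero_add, h1, hg1]
        simp
    | succ m ih =>
      refine ⟨ih.2, ?_⟩
      rw [hrec, hc, ih.1]
      simp
  refine ⟨y m, ?_, hys m, ?_⟩
  · clear hgc hrec hg1 hd hg
    induction m with
    | zero => simp [hy0]
    | succ m ih =>
      intro l
      rw [hy, pow_succ', map_mul, Module.End.mul_apply, ← ih l, ladderRep_freeForm]
  · rw [← (hgc m).1, hg]
    simp only [hU.map_zero_apply]

end IsFieldGroup

/-! ### Moments of the state as values of a functional -/

/-- The operator `∑ₗ |xₗ⟩⟨yₗ|` is trace class. -/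
theorem exists_traceClass_of_summable {n : ℕ} {x y : (Fin n → ℕ) → FockSpace n}
    (h : Summable fun l => ‖x l‖ * ‖y l‖) :
    ∃ T : FockSpace n →L[ℂ] FockSpace n, IsTraceClass T ∧
      ∀ ψ, HasSum (fun l => inner ℂ (y l) ψ • x l) (T ψ) := by
  have hs : Summable fun l => (innerSL ℂ (y l)).smulRight (x l) := by
    refine Summable.of_norm ?_
    simpa [ContinuousLinearMap.norm_smulRight_apply, mul_comm] using h
  have hT : ∀ ψ, HasSum (fun l => inner ℂ (y l) ψ • x l)
      ((∑' l, (innerSL ℂ (y l)).smulRight (x l) : FockSpace n →L[ℂ] FockSpace n) ψ) := by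
    intro ψ
    simpa using (ContinuousLinearMap.apply ℂ (FockSpace n) ψ).hasSum hs.hasSum
  refine ⟨_, ?_, hT⟩
  -- The definition of trace class uses series over `ℕ`, so the family is reindexed by an encoding
  -- and extended by zero.
  have hinj : Function.Injective (Encodable.encode : (Fin n → ℕ) → ℕ) := Encodable.encode_injective
  refine ⟨Function.extend Encodable.encode x 0, Function.extend Encodable.encode y 0, ?_,
    fun ψ => ?_⟩
  · rw [← hinj.summable_iff]
    · simpa [Function.comp_def, hinj.extend_apply] using h
    · intro k hk
      simp [Function.extend_apply' _ _ _ hk]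
  · rw [← hinj.hasSum_iff]
    · simpa [Function.comp_def, hinj.extend_apply] using hT ψ
    · intro k hk
      simp [Function.extend_apply' _ _ _ hk]

theorem LadderProductGraph.eq_ladderProduct {n : ℕ} {w : List (Ladder n)} :
    ∀ {ψ φ : FockSpace n}, LadderProductGraph w ψ φ →
      (φ : (Fin n → ℕ) → ℂ) = ladderProduct w ψ := by
  induction w with
  | nil =>
    rintro ψ φ h
    rw [show φ = ψ from h]
    rfl
  | cons i w ih =>
    rintro ψ φ ⟨χ, h, e⟩
    rw [e, ih h]
    rfl

section

variable {n : ℕ} {ρ : FockSpace n →L[ℂ] FockSpace n} {v : (Fin n → ℕ) → FockSpace n}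

/-- The operator is `∑ₗ |X vₗ⟩⟨vₗ|`. The same series for each suffix of the word supplies the
intermediate vectors required by the graph of the product. -/
theorem momentExists_and_eq (hv : Summable fun l => ‖v l‖ ^ 2)
    (hρ : ∀ ψ, HasSum (fun l => inner ℂ (v l) ψ • v l) (ρ ψ))
    {V : FreeAlgebra ℂ (Ladder n) → (Fin n → ℕ) → FockSpace n}
    (hV : ∀ P l, (V P l : (Fin n → ℕ) → ℂ) = ladderRep P (v l))
    (hVs : ∀ P, Summable fun l => ‖V P l‖ ^ 2) (w : List (Ladder n)) :
    MomentExists ρ w ∧ moment ρ w = ∑' l, inner ℂ (v l) (V (wordProd w) l) := by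
  choose T hT hTs using fun w : List (Ladder n) =>
    exists_traceClass_of_summable (summable_mul_norm_of_sq (hVs (wordProd w)) hv)
  have hgraph : ∀ (w : List (Ladder n)) (ψ : FockSpace n),
      LadderProductGraph w (ρ ψ) (T w ψ) := by
    intro w ψ
    induction w with
    | nil =>
      refine (hTs [] ψ).unique ?_
      convert hρ ψ using 3 with l
      exact lp.ext (by simp [hV, wordProd])
    | cons i w ih =>
      refine ⟨_, ih, ?_⟩
      funext k
      obtain ⟨k', c, hc⟩ := ladder_apply_eq_sum i k
      rw [hc]
      have e : ∀ l, (V (wordProd (i :: w)) l : (Fin n → ℕ) → ℂ) = ladder i (V (wordProd w) l) := by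
        intro l
        rw [hV, hV, ladderRep_wordProd, ladderRep_wordProd]
        rfl
      have h1 := (hasSum_coord (hTs w ψ) k').mul_left c
      have h2 := hasSum_coord (hTs (i :: w) ψ) k
      simp only [lp.coeFn_smul, Pi.smul_apply, smul_eq_mul, e, hc] at h1 h2
      simp only [mul_left_comm c] at h1
      exact h2.unique h1
  refine ⟨⟨T w, hgraph w, hT w⟩, ?_⟩
  rw [moment, ← tsum_tsum_eq_tsum_inner (hVs _) hv]
  refine tsum_congr fun k => ?_
  rw [← (hgraph w _).eq_ladderProduct, ← (hasSum_coord (hTs w (numberState k)) k).tsum_eq]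
  refine tsum_congr fun l => ?_
  rw [inner_numberState_right]
  rfl

/-- A family that is mapped to square summable families by all powers of the field operators is
mapped to square summable families by all polynomials in the ladder operators. -/
theorem exists_ladderRep_family
    (h : ∀ z m, ∃ y : (Fin n → ℕ) → FockSpace n,
      (∀ l, (y l : (Fin n → ℕ) → ℂ) = ladderRep (freeForm (phaseVec z) ^ m) (v l)) ∧
      Summable fun l => ‖y l‖ ^ 2) (P : FreeAlgebra ℂ (Ladder n)) :
    ∃ y : (Fin n → ℕ) → FockSpace n,
      (∀ l, (y l : (Fin n → ℕ) → ℂ) = ladderRep P (v l)) ∧ Summable fun l => ‖y l‖ ^ 2 := by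
  let N : Submodule ℂ (FreeAlgebra ℂ (Ladder n)) :=
    { carrier := {P | ∃ y : (Fin n → ℕ) → FockSpace n,
        (∀ l, (y l : (Fin n → ℕ) → ℂ) = ladderRep P (v l)) ∧ Summable fun l => ‖y l‖ ^ 2}
      zero_mem' := ⟨0, fun l => by simp; rfl, by simp⟩
      add_mem' := by
        rintro P Q ⟨y, hy, hys⟩ ⟨y', hy', hys'⟩
        refine ⟨y + y', fun l => by rw [Pi.add_apply, lp.coeFn_add, hy, hy', map_add]; rfl, ?_⟩
        refine Summable.of_nonneg_of_le (fun l => by positivity) (fun l => ?_)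
          ((hys.mul_left 2).add (hys'.mul_left 2))
        have := norm_add_le (y l) (y' l)
        rw [Pi.add_apply]
        nlinarith [sq_nonneg (‖y l‖ - ‖y' l‖), norm_nonneg (y l + y' l)]
      smul_mem' := by
        rintro c P ⟨y, hy, hys⟩
        refine ⟨c • y, fun l => by simp [hy], ?_⟩
        simpa [norm_smul, mul_pow] using hys.mul_left (‖c‖ ^ 2) }
  have hN : N = ⊤ := by
    refine submodule_eq_top_of_pow_mem (κ := fun x y => -Matrix.J (Fin n) ℂ x y)
      (fun u w x y => ?_) fun z m => h z m
    have e : ladderRep (u * (FreeAlgebra.ι ℂ x * FreeAlgebra.ι ℂ y -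
        FreeAlgebra.ι ℂ y * FreeAlgebra.ι ℂ x) * w - (-Matrix.J (Fin n) ℂ x y) • (u * w)) = 0 := by
      rw [map_sub, map_mul, map_mul, ladderRep_commutator, map_smul, map_mul, mul_smul_comm, mul_one,
        smul_mul_assoc, sub_self]
    -- The commutation relations act as zero, so the zero family is a witness.
    exact ⟨0, fun l => by rw [e]; rfl, by simp⟩
  have : P ∈ N := hN ▸ Submodule.mem_top
  exact this

/-- Respecting the commutation relations is a linear condition on the functional, so it passes to
the difference of the two sides, and polarization applies. -/
theorem tsum_inner_eq_wick {C : Matrix (Ladder n) (Ladder n) ℂ}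
    (hC : ∀ x y, C x y - C y x = -Matrix.J (Fin n) ℂ x y)
    (hv : Summable fun l => ‖v l‖ ^ 2)
    {V : FreeAlgebra ℂ (Ladder n) → (Fin n → ℕ) → FockSpace n}
    (hV : ∀ P l, (V P l : (Fin n → ℕ) → ℂ) = ladderRep P (v l))
    (hVs : ∀ P, Summable fun l => ‖V P l‖ ^ 2)
    (h : ∀ z m, ∑' l, inner ℂ (v l) (V (freeForm (phaseVec z) ^ m) l) =
      wick C (freeForm (phaseVec z) ^ m)) (P : FreeAlgebra ℂ (Ladder n)) :
    ∑' l, inner ℂ (v l) (V P l) = wick C P := by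
  have hs : ∀ P, Summable fun l => inner ℂ (v l) (V P l) := fun P =>
    Summable.of_norm_bounded (summable_mul_norm_of_sq hv (hVs P)) fun l => norm_inner_le_norm _ _
  let L : FreeAlgebra ℂ (Ladder n) →ₗ[ℂ] ℂ :=
    { toFun := fun P => ∑' l, inner ℂ (v l) (V P l)
      map_add' := fun P Q => by
        rw [← (hs P).tsum_add (hs Q)]
        refine tsum_congr fun l => ?_
        rw [← inner_add_right]
        congr 1
        exact lp.ext (by rw [lp.coeFn_add, hV, hV, hV, map_add]; rfl)
      map_smul' := fun c P => by
        rw [RingHom.id_apply, smul_eq_mul, ← tsum_mul_left]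
        refine tsum_congr fun l => ?_
        rw [← inner_smul_right]
        congr 1
        exact lp.ext (by simp [hV]) }
  have hL : RespectsCommutation (fun x y => -Matrix.J (Fin n) ℂ x y) L := by
    intro u w x y
    refine Eq.trans ?_ (L.map_smul (-Matrix.J (Fin n) ℂ x y) (u * w))
    refine tsum_congr fun l => ?_
    congr 1
    refine lp.ext ?_
    rw [hV, hV, map_mul, map_mul, ladderRep_commutator, map_smul, map_mul, mul_smul_comm, mul_one,
      smul_mul_assoc]
  have hW : RespectsCommutation (fun x y => -Matrix.J (Fin n) ℂ x y) (wick C) := by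
    intro u w x y
    exact (wick_respectsCommutation C u w x y).trans (congrArg (· * wick C (u * w)) (hC x y))
  have hsub : RespectsCommutation (fun x y => -Matrix.J (Fin n) ℂ x y) (L - wick C) := by
    intro u w x y
    rw [LinearMap.sub_apply, LinearMap.sub_apply, hL, hW, mul_sub]
  have := hsub.eq_zero fun z m => sub_eq_zero.2 (h z m)
  exact LinearMap.congr_fun (sub_eq_zero.1 this) P

end

/-! ### The Gaussian hypothesis and the conclusion -/

/-- The hypothesis supplies an unrelated group for each phase vector. Uniqueness identifies the one
at `t z` with the rescaled group at `z`; `t = 0` is covered by trace one. -/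
theorem IsGaussian.correlation_eq {n : ℕ} {ρ : FockSpace n →L[ℂ] FockSpace n}
    {C : Matrix (Ladder n) (Ladder n) ℂ} (hG : IsGaussian ρ 0 C) (htr : opTrace ρ = 1)
    {v : (Fin n → ℕ) → FockSpace n} (hv : Summable fun l => ‖v l‖ ^ 2)
    (hρ : ∀ ψ, HasSum (fun l => inner ℂ (v l) ψ • v l) (ρ ψ)) (z : Fin n → ℂ) :
    ∃ U, IsFieldGroup z U ∧ ∀ t : ℝ, ∑' l, inner ℂ (v l) (U t (v l)) =
      Complex.exp (-((phaseVec z ⬝ᵥ C.mulVec (phaseVec z)) / 2) * (t : ℂ) ^ 2) := by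
  obtain ⟨_, ⟨U, hU, -⟩, -⟩ := hG.charFun z
  refine ⟨U, hU, fun t => ?_⟩
  rw [← opTrace_mul_eq hv hρ]
  rcases eq_or_ne t 0 with rfl | ht
  · rw [hU.map_zero, one_mul, htr]
    simp
  · obtain ⟨W, ⟨U', hU', rfl⟩, hW⟩ := hG.charFun ((t : ℂ) • z)
    rw [hU'.ext (hU.scale ht)] at hW
    simp only [one_mul] at hW
    rw [hW, phaseVec_ofReal_smul]
    simp only [zero_dotProduct, Matrix.mulVec_smul, smul_dotProduct, dotProduct_smul,
      smul_eq_mul]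
    congr 1
    linear_combination (1 / 2 * (t : ℂ) ^ 2 * (phaseVec z ⬝ᵥ C.mulVec (phaseVec z))) *
      Complex.I_mul_I

theorem J_antisymm {n : ℕ} (x y : Ladder n) :
    Matrix.J (Fin n) ℂ y x = -Matrix.J (Fin n) ℂ x y := by
  have := congrFun (congrFun (Matrix.J_transpose (Fin n) ℂ) x) y
  simpa using this

end

theorem theorem2 {n : ℕ} (ρ : FockSpace n →L[ℂ] FockSpace n) (hρ : IsDensityOperator ρ)
    (C : Matrix (Ladder n) (Ladder n) ℂ) (hG : IsGaussian ρ 0 C) :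
    secondCentralMoments ρ = C - (1 / 2 : ℂ) • Matrix.J (Fin n) ℂ ∧
    ∀ (I : Finset ℕ) (c : ℕ → Ladder n),
      MomentExists ρ (indexWord c I) ∧
      moment ρ (indexWord c I) = pairingSum (secondCentralMoments ρ) c I := by
  obtain ⟨v, hv, hρv⟩ := exists_decomposition hρ.isPositive hρ.trace_eq_one
  -- The characteristic function sees only the symmetric part `C`; the commutation relations force
  -- the antisymmetric part `-J / 2`, which drops out of the quadratic form in `hq`.
  set D : Matrix (Ladder n) (Ladder n) ℂ := C - (1 / 2 : ℂ) • Matrix.J (Fin n) ℂ with hD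
  have hDapp : ∀ x y, D x y = C x y - 1 / 2 * Matrix.J (Fin n) ℂ x y := fun x y => by simp [hD]
  have hDJ : ∀ x y, D x y - D y x = -Matrix.J (Fin n) ℂ x y := by
    intro x y
    rw [hDapp, hDapp, J_antisymm x y, hG.isSymm.apply x y]
    ring
  have hq : ∀ f : Ladder n → ℂ, ∑ x, ∑ y, f x * f y * D x y = f ⬝ᵥ C.mulVec f := by
    intro f
    have hJ : ∑ x, ∑ y, f x * f y * Matrix.J (Fin n) ℂ x y = 0 := by
      have : ∑ x, ∑ y, f x * f y * Matrix.J (Fin n) ℂ x y =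
          -∑ x, ∑ y, f x * f y * Matrix.J (Fin n) ℂ x y := by
        conv_lhs => rw [Finset.sum_comm]
        simp only [← Finset.sum_neg_distrib]
        refine Finset.sum_congr rfl fun x _ => Finset.sum_congr rfl fun y _ => ?_
        rw [J_antisymm x y]
        ring
      exact self_eq_neg.1 this
    have : ∑ x, ∑ y, f x * f y * D x y = ∑ x, ∑ y, f x * f y * C x y -
        1 / 2 * ∑ x, ∑ y, f x * f y * Matrix.J (Fin n) ℂ x y := by
      simp only [Finset.mul_sum, ← Finset.sum_sub_distrib, hDapp]
      exact Finset.sum_congr rfl fun x _ => Finset.sum_congr rfl fun y _ => by ring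
    rw [this, hJ, mul_zero, sub_zero]
    simp only [dotProduct, Matrix.mulVec, Finset.mul_sum]
    exact Finset.sum_congr rfl fun x _ => Finset.sum_congr rfl fun y _ => by ring
  have hpow : ∀ z m, ∃ y : (Fin n → ℕ) → FockSpace n,
      (∀ l, (y l : (Fin n → ℕ) → ℂ) = ladderRep (freeForm (phaseVec z) ^ m) (v l)) ∧
      (Summable fun l => ‖y l‖ ^ 2) ∧
      ∑' l, inner ℂ (v l) (y l) = wick D (freeForm (phaseVec z) ^ m) := by
    intro z m
    obtain ⟨U, hU, hf⟩ := hG.correlation_eq hρ.trace_eq_one hv hρv z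
    refine hU.gaussian_moments hv hf (c := fun m => wick D (freeForm (phaseVec z) ^ m)) ?_ ?_ ?_ m
    · simp [wick_one]
    · simp [wick_freeForm]
    · intro m
      rw [wick_pow, hq]
  choose V hV hVs using exists_ladderRep_family fun z m =>
    (hpow z m).imp fun y hy => ⟨hy.1, hy.2.1⟩
  have hwick := tsum_inner_eq_wick hDJ hv hV hVs fun z m => by
    obtain ⟨y, hy, -, hy'⟩ := hpow z m
    rw [← hy']
    refine tsum_congr fun l => ?_
    congr 1
    exact lp.ext (by rw [hV, hy])
  have hmoment : ∀ w, MomentExists ρ w ∧ moment ρ w = wick D (wordProd w) := by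
    intro w
    rw [← hwick]
    exact momentExists_and_eq hv hρv hV hVs w
  have hsecond : secondCentralMoments ρ = D := by
    ext i j
    have h1 : moment ρ [i] = 0 := by
      rw [(hmoment _).2, wordProd, List.map_singleton, List.prod_singleton, ← freeForm_single,
        wick_freeForm]
    have h2 : moment ρ [i, j] = D i j := by
      rw [(hmoment _).2, ← wick_ι_mul_ι D i j]
      simp [wordProd]
    rw [secondCentralMoments, Matrix.of_apply, h1, h2, zero_mul, sub_zero]
  refine ⟨hsecond, fun I c => ⟨(hmoment _).1, ?_⟩⟩
  rw [(hmoment _).2, hsecond, wick_wordProd_indexWord]
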